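/- Conventions. All algebras are associative algebras over $\mathbb C$, with or without identity, whose product is non-degenerate ($ab=0$ for all $b$ implies $a=0$, and $ba=0$ for all $b$ implies $a=0$). $M(A)$ denotes the multiplier algebra of $A$, and $\iota$ the identity map. A regular comultiplication on $A$ is a linear map $\Delta:A\to M(A\otimes A)$ (not assumed to be a homomorphism) such that $\Delta(a)(1\otimes b)$, $(a\otimes 1)\Delta(b)$, $\Delta(a)(b\otimes 1)$ and $(1\otimes a)\Delta(b)$ lie in $A\otimes A$ for all $a,b\in A$, and $$(a\otimes1\otimes1)(\Delta\otimes\iota)(\Delta(b)(1\otimes c))=(\iota\otimes\Delta)((a\otimes1)\Delta(b))(1\otimes1\otimes c)\qquad(a,b,c\in A).$$ An algebraic quantum hypergroup is a pair $(A,\Delta)$ of such an algebra and a regular comultiplication for which there exist a counit, that is, a homomorphism $\varepsilon:A\to\mathbb C$ with $(\varepsilon\otimes\iota)\Delta(a)=a=(\iota\otimes\varepsilon)\Delta(a)$ for all $a$, a faithful left integral, that is, a non-zero linear functional $\varphi$ on $A$ with $(\iota\otimes\varphi)\Delta(a)=\varphi(a)1$ in $M(A)$ for all $a$, such that $\varphi(ab)=0$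 for all $b$, or $\varphi(ba)=0$ for all $b$, implies $a=0$, and an antipode relative to $\varphi$, that is, a bijective linear anti-homomorphism $S:A\to A$ with $S((\iota\otimes\varphi)(\Delta(a)(1\otimes b)))=(\iota\otimes\varphi)((1\otimes a)\Delta(b))$ for all $a,b\in A$. The dual $(\widehat A,\widehat\Delta)$ of $(A,\Delta)$ consists of the space $\widehat A=\{\varphi(\,\cdot\,a)\mid a\in A\}$ of linear functionals on $A$, with the product $(\omega\omega')(x)=(\omega\otimes\omega')\Delta(x)$ and the comultiplication $\widehat\Delta:\widehat A\to M(\widehat A\otimes\widehat A)$ determined by $$\langle(\omega_1\otimes1)\widehat\Delta(\omega_2),x\otimes y\rangle=(\omega_1\otimes\omega_2)(\Delta(x)(1\otimes y)),\qquad\langle\widehat\Delta(\omega_1)(1\otimes\omega_2),x\otimes y\rangle=(\omega_1\otimes\omega_2)((x\otimes1)\Delta(y))$$ for $x,y\in A$; it is again an algebraic quantum hypergroup, with counit $\widehat\varepsilon(\varphi(\,\cdot\,a))=\varphi(a)$. An algebraic quantum hypergroup $(A,\Delta)$ with counit $\varepsilon$ is of compact type if the algebra $A$ has an identity. It is of discrete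 type if it has a left co-integral, that is, a non-zero $h\in A$ with $ah=\varepsilon(a)h$ for all $a\in A$. Proposition. Let $(A,\Delta)$ be an algebraic quantum hypergroup and $(\widehat A,\widehat\Delta)$ its dual. Then $(A,\Delta)$ is of compact type if and only if $(\widehat A,\widehat\Delta)$ is of discrete type. -/

import Mathlib

open scoped TensorProduct

namespace QuantumHypergroup

set_option linter.unusedSectionVars false

section Algebra

variable {B : Type*} [NonUnitalRing B] [Module ℂ B] [IsScalarTower ℂ B B] [SMulCommClass ℂ B B]

/-- The product of an algebra (possibly without unit) is non-degenerate. -/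
def NondegenerateMul (B : Type*) [NonUnitalRing B] : Prop :=
  (∀ x : B, (∀ y, x * y = 0) → x = 0) ∧ (∀ x : B, (∀ y, y * x = 0) → x = 0)

/-- A linear functional is faithful. -/
def IsFaithful (f : B →ₗ[ℂ] ℂ) : Prop :=
  (∀ x : B, (∀ y, f (x * y) = 0) → x = 0) ∧ (∀ x : B, (∀ y, f (y * x) = 0) → x = 0)

/-- The multiplier algebra `M(B)`: pairs `(λ, ρ)` of linear maps, `λ` being left multiplication
`x ↦ m x` and `ρ` being right multiplication `x ↦ x m` by the multiplier `m`. -/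
def multiplierAlgebra (B : Type*) [NonUnitalRing B] [Module ℂ B] [IsScalarTower ℂ B B]
    [SMulCommClass ℂ B B] : Subalgebra ℂ (Module.End ℂ B × (Module.End ℂ B)ᵐᵒᵖ) where
  carrier := {m | (∀ x y, m.1 (x * y) = m.1 x * y) ∧
    (∀ x y, m.2.unop (x * y) = x * m.2.unop y) ∧ ∀ x y, x * m.1 y = m.2.unop x * y}
  mul_mem' := by
    rintro m n ⟨h1, h2, h3⟩ ⟨k1, k2, k3⟩
    refine ⟨fun x y => ?_, fun x y => ?_, fun x y => ?_⟩
    · simp [h1, k1]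
    · simp [h2, k2]
    · simp [h3, k3]
  add_mem' := by
    rintro m n ⟨h1, h2, h3⟩ ⟨k1, k2, k3⟩
    refine ⟨fun x y => ?_, fun x y => ?_, fun x y => ?_⟩
    · simp [h1, k1, add_mul]
    · simp [h2, k2, mul_add]
    · simp [h3, k3, mul_add, add_mul]
  algebraMap_mem' := by
    intro r
    refine ⟨fun x y => ?_, fun x y => ?_, fun x y => ?_⟩ <;>
      simp [Module.algebraMap_end_apply, smul_mul_assoc, mul_smul_comm]

/-- Elements of the multiplier algebra `M(B)`. -/
abbrev Multiplier (B : Type*) [NonUnitalRing B] [Module ℂ B] [IsScalarTower ℂ B B]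
    [SMulCommClass ℂ B B] : Type _ := multiplierAlgebra B

namespace Multiplier

/-- `x ↦ m x`. -/
def left (m : Multiplier B) : B →ₗ[ℂ] B := m.1.1

/-- `x ↦ x m`. -/
def right (m : Multiplier B) : B →ₗ[ℂ] B := m.1.2.unop

/-- A multiplier from its left and right multiplication operators. -/
def mk (l r : B →ₗ[ℂ] B) (hl : ∀ x y, l (x * y) = l x * y) (hr : ∀ x y, r (x * y) = x * r y)
    (hlr : ∀ x y, x * l y = r x * y) : Multiplier B :=
  ⟨(l, MulOpposite.op r), hl, hr, hlr⟩

@[simp] lemma left_mk (l r : B →ₗ[ℂ] B) (hl hr hlr) : left (mk l r hl hr hlr) = l := rfl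

@[simp] lemma right_mk (l r : B →ₗ[ℂ] B) (hl hr hlr) : right (mk l r hl hr hlr) = r := rfl

lemma left_mul_apply (m n : Multiplier B) (x : B) : left (m * n) x = left m (left n x) := rfl

lemma right_mul_apply (m n : Multiplier B) (x : B) : right (m * n) x = right n (right m x) := rfl

@[simp] lemma left_one : left (1 : Multiplier B) = LinearMap.id := rfl

@[simp] lemma right_one : right (1 : Multiplier B) = LinearMap.id := rfl

@[simp] lemma left_add (m n : Multiplier B) : left (m + n) = left m + left n := rfl

@[simp] lemma right_add (m n : Multiplier B) : right (m + n) = right m + right n := rfl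

@[simp] lemma left_smul (c : ℂ) (m : Multiplier B) : left (c • m) = c • left m := rfl

@[simp] lemma right_smul (c : ℂ) (m : Multiplier B) : right (c • m) = c • right m := rfl

lemma left_map_mul (m : Multiplier B) (x y : B) : left m (x * y) = left m x * y := m.2.1 x y

lemma right_map_mul (m : Multiplier B) (x y : B) : right m (x * y) = x * right m y := m.2.2.1 x y

lemma mul_left (m : Multiplier B) (x y : B) : x * left m y = right m x * y := m.2.2.2 x y

lemma ext' {m n : Multiplier B} (h1 : ∀ x, left m x = left n x)
    (h2 : ∀ x, right m x = right n x) : m = n :=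
  Subtype.ext (Prod.ext (LinearMap.ext h1) (MulOpposite.unop_injective (LinearMap.ext h2)))

lemma ext_left (hB : NondegenerateMul B) {m n : Multiplier B}
    (h : ∀ x, left m x = left n x) : m = n := by
  refine ext' h fun x => sub_eq_zero.1 (hB.1 _ fun y => ?_)
  rw [sub_mul, ← mul_left, ← mul_left, h, sub_self]

lemma ext_right (hB : NondegenerateMul B) {m n : Multiplier B}
    (h : ∀ x, right m x = right n x) : m = n := by
  refine ext' (fun x => sub_eq_zero.1 (hB.2 _ fun y => ?_)) h
  rw [mul_sub, mul_left, mul_left, h, sub_self]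

/-- The canonical map `B → M(B)`. -/
def of : B →ₗ[ℂ] Multiplier B where
  toFun b := mk (LinearMap.mulLeft ℂ b) (LinearMap.mulRight ℂ b)
    (fun x y => by simp [mul_assoc]) (fun x y => by simp [mul_assoc])
    (fun x y => by simp [mul_assoc])
  map_add' a b := ext' (fun x => add_mul a b x) (fun x => mul_add x a b)
  map_smul' c a := ext' (fun x => smul_mul_assoc c a x) (fun x => mul_smul_comm c x a)

@[simp] lemma left_of (b x : B) : left (of b) x = b * x := rfl

@[simp] lemma right_of (b x : B) : right (of b) x = x * b := rfl

lemma of_injective (hB : NondegenerateMul B) : Function.Injective (of : B →ₗ[ℂ] Multiplier B) := by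
  intro a b h
  refine sub_eq_zero.1 (hB.1 _ fun y => ?_)
  have := congrArg (fun m => left m y) h
  simp only [left_of] at this
  rw [sub_mul, this, sub_self]

lemma of_left (m : Multiplier B) (x : B) : of (left m x) = m * of x :=
  ext' (fun y => by simp [left_mul_apply, left_map_mul])
    (fun y => by simp [right_mul_apply, mul_left])

lemma of_right (m : Multiplier B) (x : B) : of (right m x) = of x * m :=
  ext' (fun y => by simp [left_mul_apply, mul_left])
    (fun y => by simp [right_mul_apply, right_map_mul])

end Multiplier

end Algebra

section Tensor

variable {A : Type*} [NonUnitalRing A] [Module ℂ A] [IsScalarTower ℂ A A] [SMulCommClass ℂ A A]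
variable {V W : Type*} [AddCommGroup V] [Module ℂ V] [AddCommGroup W] [Module ℂ W]

/-- The embedding of `M(A) ⊗ M(A)` in `M(A ⊗ A)`, on elementary tensors. -/
noncomputable def Multiplier.tmul (m n : Multiplier A) : Multiplier (A ⊗[ℂ] A) :=
  Multiplier.mk (TensorProduct.map m.left n.left) (TensorProduct.map m.right n.right)
    (fun x y => by
      induction x with
      | zero => simp
      | add x x' hx hx' => simp only [add_mul, map_add, hx, hx']
      | tmul a b =>
        induction y with
        | zero => simp
        | add y y' hy hy' => simp only [mul_add, map_add, hy, hy']
        | tmul c d => simp [Multiplier.left_map_mul])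
    (fun x y => by
      induction x with
      | zero => simp
      | add x x' hx hx' => simp only [add_mul, map_add, hx, hx']
      | tmul a b =>
        induction y with
        | zero => simp
        | add y y' hy hy' => simp only [mul_add, map_add, hy, hy']
        | tmul c d => simp [Multiplier.right_map_mul])
    (fun x y => by
      induction x with
      | zero => simp
      | add x x' hx hx' => simp only [add_mul, map_add, hx, hx']
      | tmul a b =>
        induction y with
        | zero => simp
        | add y y' hy hy' => simp only [mul_add, map_add, hy, hy']
        | tmul c d => simp [Multiplier.mul_left])

/-- The slice map `ω ⊗ ι`. -/
noncomputable def sliceL (ω : V →ₗ[ℂ] ℂ) : V ⊗[ℂ] W →ₗ[ℂ] W :=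
  (TensorProduct.lid ℂ W).toLinearMap ∘ₗ TensorProduct.map ω LinearMap.id

/-- The slice map `ι ⊗ ω`. -/
noncomputable def sliceR (ω : W →ₗ[ℂ] ℂ) : V ⊗[ℂ] W →ₗ[ℂ] V :=
  (TensorProduct.rid ℂ V).toLinearMap ∘ₗ TensorProduct.map LinearMap.id ω

@[simp] lemma sliceL_tmul (ω : V →ₗ[ℂ] ℂ) (v : V) (w : W) : sliceL ω (v ⊗ₜ[ℂ] w) = ω v • w := by
  simp [sliceL]

@[simp] lemma sliceR_tmul (ω : W →ₗ[ℂ] ℂ) (v : V) (w : W) : sliceR ω (v ⊗ₜ[ℂ] w) = ω w • v := by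
  simp [sliceR]

lemma eq_zero_of_sliceR {t : V ⊗[ℂ] W} (h : ∀ ω : W →ₗ[ℂ] ℂ, sliceR ω t = 0) : t = 0 := by
  classical
  let b := Module.Basis.ofVectorSpace ℂ W
  apply (TensorProduct.equivFinsuppOfBasisRight (M := V) b).injective
  rw [map_zero]
  ext i
  rw [Finsupp.zero_apply, ← h (b.coord i)]
  have : Finsupp.lapply i ∘ₗ (TensorProduct.equivFinsuppOfBasisRight (M := V) b).toLinearMap
      = sliceR (b.coord i) := TensorProduct.ext' fun v w => by simp
  exact LinearMap.congr_fun this t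

lemma eq_zero_of_slice {t : V ⊗[ℂ] W}
    (h : ∀ (f : V →ₗ[ℂ] ℂ) (g : W →ₗ[ℂ] ℂ), f (sliceR g t) = 0) : t = 0 :=
  eq_zero_of_sliceR fun g => (Module.forall_dual_apply_eq_zero_iff ℂ _).1 fun f => h f g

lemma sliceR_sliceL (f : V →ₗ[ℂ] ℂ) (g : W →ₗ[ℂ] ℂ) (t : V ⊗[ℂ] W) :
    f (sliceR g t) = g (sliceL f t) := by
  have : f ∘ₗ sliceR g = g ∘ₗ sliceL f := TensorProduct.ext' fun v w => by simp [mul_comm]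
  exact LinearMap.congr_fun this t

lemma sliceL_ext {t u : V ⊗[ℂ] W} (h : ∀ f : V →ₗ[ℂ] ℂ, sliceL f t = sliceL f u) : t = u := by
  refine sub_eq_zero.1 (eq_zero_of_slice fun f g => ?_)
  rw [sliceR_sliceL, map_sub, h, sub_self, map_zero]

lemma sliceR_ext {t u : V ⊗[ℂ] W} (h : ∀ f : W →ₗ[ℂ] ℂ, sliceR f t = sliceR f u) : t = u :=
  sub_eq_zero.1 (eq_zero_of_sliceR fun g => by rw [map_sub, h, sub_self])

lemma sliceL_map {V' W' : Type*} [AddCommGroup V'] [Module ℂ V'] [AddCommGroup W'] [Module ℂ W']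
    (ω : V' →ₗ[ℂ] ℂ) (p : V →ₗ[ℂ] V') (q : W →ₗ[ℂ] W') (t : V ⊗[ℂ] W) :
    sliceL ω (TensorProduct.map p q t) = q (sliceL (ω ∘ₗ p) t) := by
  have : sliceL ω ∘ₗ TensorProduct.map p q = q ∘ₗ sliceL (ω ∘ₗ p) :=
    TensorProduct.ext' fun v w => by simp
  exact LinearMap.congr_fun this t

lemma sliceR_map {V' W' : Type*} [AddCommGroup V'] [Module ℂ V'] [AddCommGroup W'] [Module ℂ W']
    (ω : W' →ₗ[ℂ] ℂ) (p : V →ₗ[ℂ] V') (q : W →ₗ[ℂ] W') (t : V ⊗[ℂ] W) :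
    sliceR ω (TensorProduct.map p q t) = p (sliceR (ω ∘ₗ q) t) := by
  have : sliceR ω ∘ₗ TensorProduct.map p q = p ∘ₗ sliceR (ω ∘ₗ q) :=
    TensorProduct.ext' fun v w => by simp
  exact LinearMap.congr_fun this t

/-- Multiplying the first leg from the left or from the right is injective in the sense of
non-degeneracy; likewise for the second leg. -/
lemma tensor_cancel₁ (hA : NondegenerateMul A) {t u : A ⊗[ℂ] W}
    (h : ∀ c, TensorProduct.map (LinearMap.mulLeft ℂ c) LinearMap.id t
      = TensorProduct.map (LinearMap.mulLeft ℂ c) LinearMap.id u) : t = u := by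
  refine sliceR_ext fun g => sub_eq_zero.1 (hA.2 _ fun c => ?_)
  have := congrArg (sliceR g) (h c)
  rw [sliceR_map, sliceR_map] at this
  rw [mul_sub]
  exact sub_eq_zero.2 this

lemma tensor_cancel₂ (hA : NondegenerateMul A) {t u : A ⊗[ℂ] W}
    (h : ∀ c, TensorProduct.map (LinearMap.mulRight ℂ c) LinearMap.id t
      = TensorProduct.map (LinearMap.mulRight ℂ c) LinearMap.id u) : t = u := by
  refine sliceR_ext fun g => sub_eq_zero.1 (hA.1 _ fun c => ?_)
  have := congrArg (sliceR g) (h c)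
  rw [sliceR_map, sliceR_map] at this
  rw [sub_mul]
  exact sub_eq_zero.2 this

lemma tensor_cancel₃ (hA : NondegenerateMul A) {t u : V ⊗[ℂ] A}
    (h : ∀ c, TensorProduct.map LinearMap.id (LinearMap.mulLeft ℂ c) t
      = TensorProduct.map LinearMap.id (LinearMap.mulLeft ℂ c) u) : t = u := by
  refine sliceL_ext fun g => sub_eq_zero.1 (hA.2 _ fun c => ?_)
  have := congrArg (sliceL g) (h c)
  rw [sliceL_map, sliceL_map] at this
  rw [mul_sub]
  exact sub_eq_zero.2 this

lemma tensor_cancel₄ (hA : NondegenerateMul A) {t u : V ⊗[ℂ] A}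
    (h : ∀ c, TensorProduct.map LinearMap.id (LinearMap.mulRight ℂ c) t
      = TensorProduct.map LinearMap.id (LinearMap.mulRight ℂ c) u) : t = u := by
  refine sliceL_ext fun g => sub_eq_zero.1 (hA.1 _ fun c => ?_)
  have := congrArg (sliceL g) (h c)
  rw [sliceL_map, sliceL_map] at this
  rw [sub_mul]
  exact sub_eq_zero.2 this

lemma nondegenerateMul_tensor (hA : NondegenerateMul A) : NondegenerateMul (A ⊗[ℂ] A) := by
  constructor
  · intro t ht
    refine tensor_cancel₂ hA fun c => tensor_cancel₄ hA fun d => ?_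
    have : TensorProduct.map LinearMap.id (LinearMap.mulRight ℂ d) ∘ₗ
        TensorProduct.map (LinearMap.mulRight ℂ c) LinearMap.id
        = LinearMap.mulRight ℂ (c ⊗ₜ[ℂ] d : A ⊗[ℂ] A) := TensorProduct.ext' fun v w => by simp
    have h2 := LinearMap.congr_fun this t
    simp only [LinearMap.comp_apply, LinearMap.mulRight_apply, ht] at h2
    rw [h2, map_zero, map_zero]
  · intro t ht
    refine tensor_cancel₁ hA fun c => tensor_cancel₃ hA fun d => ?_
    have : TensorProduct.map LinearMap.id (LinearMap.mulLeft ℂ d) ∘ₗ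
        TensorProduct.map (LinearMap.mulLeft ℂ c) LinearMap.id
        = LinearMap.mulLeft ℂ (c ⊗ₜ[ℂ] d : A ⊗[ℂ] A) := TensorProduct.ext' fun v w => by simp
    have h2 := LinearMap.congr_fun this t
    simp only [LinearMap.comp_apply, LinearMap.mulLeft_apply, ht] at h2
    rw [h2, map_zero, map_zero]

end Tensor

section Comultiplication

variable {A : Type*} [NonUnitalRing A] [Module ℂ A] [IsScalarTower ℂ A A] [SMulCommClass ℂ A A]

/-- An algebra `A` with non-degenerate product, together with a regular comultiplication
`Δ : A → M(A ⊗ A)`. The bilinear maps `T₁, …, T₄` record that the four products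
`Δ(a)(1 ⊗ b)`, `(a ⊗ 1)Δ(b)`, `Δ(a)(b ⊗ 1)`, `(1 ⊗ a)Δ(b)` lie in `A ⊗ A`; they are uniquely
determined by `Δ`, since `A ⊗ A → M(A ⊗ A)` is injective. -/
structure RegularComultiplication (A : Type*) [NonUnitalRing A] [Module ℂ A] [IsScalarTower ℂ A A]
    [SMulCommClass ℂ A A] where
  nondegenerate : NondegenerateMul A
  comul : A →ₗ[ℂ] Multiplier (A ⊗[ℂ] A)
  T₁ : A →ₗ[ℂ] A →ₗ[ℂ] A ⊗[ℂ] A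
  T₂ : A →ₗ[ℂ] A →ₗ[ℂ] A ⊗[ℂ] A
  T₃ : A →ₗ[ℂ] A →ₗ[ℂ] A ⊗[ℂ] A
  T₄ : A →ₗ[ℂ] A →ₗ[ℂ] A ⊗[ℂ] A
  of_T₁ : ∀ a b, Multiplier.of (T₁ a b) = comul a * Multiplier.tmul 1 (Multiplier.of b)
  of_T₂ : ∀ a b, Multiplier.of (T₂ a b) = Multiplier.tmul (Multiplier.of a) 1 * comul b
  of_T₃ : ∀ a b, Multiplier.of (T₃ a b) = comul a * Multiplier.tmul (Multiplier.of b) 1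
  of_T₄ : ∀ a b, Multiplier.of (T₄ a b) = Multiplier.tmul 1 (Multiplier.of a) * comul b
  /-- Coassociativity:
  `(a ⊗ 1 ⊗ 1)(Δ ⊗ ι)(Δ(b)(1 ⊗ c)) = (ι ⊗ Δ)((a ⊗ 1)Δ(b))(1 ⊗ 1 ⊗ c)`. -/
  coassoc : ∀ a b c,
    TensorProduct.assoc ℂ A A A (TensorProduct.map (T₂ a) LinearMap.id (T₁ b c))
      = TensorProduct.map LinearMap.id (T₁.flip c) (T₂ a b)

namespace RegularComultiplication

variable (D : RegularComultiplication A)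

lemma of_inj (D : RegularComultiplication A) {t u : A ⊗[ℂ] A} (h : Multiplier.of t = Multiplier.of u) : t = u :=
  Multiplier.of_injective (nondegenerateMul_tensor D.nondegenerate) h

lemma tmul_comm (c d : A) :
    Multiplier.tmul (Multiplier.of c) 1 * Multiplier.tmul 1 (Multiplier.of d)
      = Multiplier.tmul 1 (Multiplier.of d) * Multiplier.tmul (Multiplier.of c) 1 := by
  refine Multiplier.ext' (fun x => ?_) (fun x => ?_)
  · induction x with
    | zero => simp
    | add x y hx hy => simp only [map_add, hx, hy]
    | tmul x y => rfl
  · induction x with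
    | zero => simp
    | add x y hx hy => simp only [map_add, hx, hy]
    | tmul x y => rfl

lemma of_l1 (c : A) (t : A ⊗[ℂ] A) :
    Multiplier.of (TensorProduct.map (LinearMap.mulLeft ℂ c) LinearMap.id t)
      = Multiplier.tmul (Multiplier.of c) 1 * Multiplier.of t :=
  Multiplier.of_left (Multiplier.tmul (Multiplier.of c) 1) t

lemma of_l2 (c : A) (t : A ⊗[ℂ] A) :
    Multiplier.of (TensorProduct.map LinearMap.id (LinearMap.mulLeft ℂ c) t)
      = Multiplier.tmul 1 (Multiplier.of c) * Multiplier.of t :=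
  Multiplier.of_left (Multiplier.tmul 1 (Multiplier.of c)) t

lemma of_r1 (c : A) (t : A ⊗[ℂ] A) :
    Multiplier.of (TensorProduct.map (LinearMap.mulRight ℂ c) LinearMap.id t)
      = Multiplier.of t * Multiplier.tmul (Multiplier.of c) 1 :=
  Multiplier.of_right (Multiplier.tmul (Multiplier.of c) 1) t

lemma of_r2 (c : A) (t : A ⊗[ℂ] A) :
    Multiplier.of (TensorProduct.map LinearMap.id (LinearMap.mulRight ℂ c) t)
      = Multiplier.of t * Multiplier.tmul 1 (Multiplier.of c) :=
  Multiplier.of_right (Multiplier.tmul 1 (Multiplier.of c)) t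

lemma R12 (a b c : A) : TensorProduct.map (LinearMap.mulLeft ℂ c) LinearMap.id (D.T₁ a b)
    = TensorProduct.map LinearMap.id (LinearMap.mulRight ℂ b) (D.T₂ c a) :=
  D.of_inj (by rw [of_l1, of_r2, of_T₁, of_T₂, mul_assoc])

lemma R13 (a b c : A) : TensorProduct.map (LinearMap.mulRight ℂ c) LinearMap.id (D.T₁ a b)
    = TensorProduct.map LinearMap.id (LinearMap.mulRight ℂ b) (D.T₃ a c) :=
  D.of_inj (by rw [of_r1, of_r2, of_T₁, of_T₃, mul_assoc, mul_assoc, tmul_comm])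

lemma R14 (a b c : A) : TensorProduct.map LinearMap.id (LinearMap.mulLeft ℂ c) (D.T₁ a b)
    = TensorProduct.map LinearMap.id (LinearMap.mulRight ℂ b) (D.T₄ c a) :=
  D.of_inj (by rw [of_l2, of_r2, of_T₁, of_T₄, mul_assoc])

lemma R32 (a b c : A) : TensorProduct.map (LinearMap.mulLeft ℂ c) LinearMap.id (D.T₃ a b)
    = TensorProduct.map (LinearMap.mulRight ℂ b) LinearMap.id (D.T₂ c a) :=
  D.of_inj (by rw [of_l1, of_r1, of_T₃, of_T₂, mul_assoc])

lemma R34 (a b c : A) : TensorProduct.map LinearMap.id (LinearMap.mulLeft ℂ c) (D.T₃ a b)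
    = TensorProduct.map (LinearMap.mulRight ℂ b) LinearMap.id (D.T₄ c a) :=
  D.of_inj (by rw [of_l2, of_r1, of_T₃, of_T₄, mul_assoc])

lemma tmul_one_mul (c d : A) : Multiplier.tmul 1 (Multiplier.of (c * d))
    = Multiplier.tmul 1 (Multiplier.of c) * Multiplier.tmul 1 (Multiplier.of d) := by
  refine Multiplier.ext' (fun x => ?_) (fun x => ?_)
  · induction x with
    | zero => simp
    | add x y hx hy => simp only [map_add, hx, hy]
    | tmul x y => simp [Multiplier.left_mul_apply, Multiplier.tmul, mul_assoc]
  · induction x with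
    | zero => simp
    | add x y hx hy => simp only [map_add, hx, hy]
    | tmul x y => simp [Multiplier.right_mul_apply, Multiplier.tmul, mul_assoc]

lemma tmul_mul_one (c d : A) : Multiplier.tmul (Multiplier.of (c * d)) 1
    = Multiplier.tmul (Multiplier.of c) 1 * Multiplier.tmul (Multiplier.of d) 1 := by
  refine Multiplier.ext' (fun x => ?_) (fun x => ?_)
  · induction x with
    | zero => simp
    | add x y hx hy => simp only [map_add, hx, hy]
    | tmul x y => simp [Multiplier.left_mul_apply, Multiplier.tmul, mul_assoc]
  · induction x with
    | zero => simp
    | add x y hx hy => simp only [map_add, hx, hy]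
    | tmul x y => simp [Multiplier.right_mul_apply, Multiplier.tmul, mul_assoc]

lemma R11 (a b c : A) : D.T₁ a (b * c)
    = TensorProduct.map LinearMap.id (LinearMap.mulRight ℂ c) (D.T₁ a b) :=
  D.of_inj (by rw [of_r2, of_T₁, of_T₁, tmul_one_mul, mul_assoc])

lemma R22 (a b c : A) : D.T₂ (b * c) a
    = TensorProduct.map (LinearMap.mulLeft ℂ b) LinearMap.id (D.T₂ c a) :=
  D.of_inj (by rw [of_l1, of_T₂, of_T₂, tmul_mul_one, mul_assoc])

lemma R33 (a b c : A) : D.T₃ a (b * c)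
    = TensorProduct.map (LinearMap.mulRight ℂ c) LinearMap.id (D.T₃ a b) :=
  D.of_inj (by rw [of_r1, of_T₃, of_T₃, tmul_mul_one, mul_assoc])

lemma R44 (a b c : A) : D.T₄ (b * c) a
    = TensorProduct.map LinearMap.id (LinearMap.mulLeft ℂ b) (D.T₄ c a) :=
  D.of_inj (by rw [of_l2, of_T₄, of_T₄, tmul_one_mul, mul_assoc])

/-- The multiplier `(ω ⊗ ι)Δ(a)` of `A`: one has `((ω ⊗ ι)Δ(a)) c = (ω ⊗ ι)(Δ(a)(1 ⊗ c))` and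
`c ((ω ⊗ ι)Δ(a)) = (ω ⊗ ι)((1 ⊗ c)Δ(a))`. -/
noncomputable def sliceLeft (ω : A →ₗ[ℂ] ℂ) (a : A) : Multiplier A :=
  Multiplier.mk (sliceL ω ∘ₗ D.T₁ a) (sliceL ω ∘ₗ D.T₄.flip a)
    (fun c d => by
      simp only [LinearMap.comp_apply, R11, sliceL_map, LinearMap.mulRight_apply]; rfl)
    (fun c d => by
      simp only [LinearMap.comp_apply, LinearMap.flip_apply, R44, sliceL_map,
        LinearMap.mulLeft_apply]; rfl)
    (fun c d => by
      have := congrArg (sliceL ω) (D.R14 a d c)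
      rwa [sliceL_map, sliceL_map] at this)

/-- The multiplier `(ι ⊗ ω)Δ(a)` of `A`: one has `((ι ⊗ ω)Δ(a)) c = (ι ⊗ ω)(Δ(a)(c ⊗ 1))` and
`c ((ι ⊗ ω)Δ(a)) = (ι ⊗ ω)((c ⊗ 1)Δ(a))`. -/
noncomputable def sliceRight (ω : A →ₗ[ℂ] ℂ) (a : A) : Multiplier A :=
  Multiplier.mk (sliceR ω ∘ₗ D.T₃ a) (sliceR ω ∘ₗ D.T₂.flip a)
    (fun c d => by
      simp only [LinearMap.comp_apply, R33, sliceR_map, LinearMap.mulRight_apply]; rfl)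
    (fun c d => by
      simp only [LinearMap.comp_apply, LinearMap.flip_apply, R22, sliceR_map,
        LinearMap.mulLeft_apply]; rfl)
    (fun c d => by
      have := congrArg (sliceR ω) (D.R32 a d c)
      rwa [sliceR_map, sliceR_map] at this)

/-- A counit: a homomorphism `ε : A → ℂ` with `(ε ⊗ ι)Δ(a) = a` and `(ι ⊗ ε)Δ(a) = a`. -/
def IsCounit (ε : A →ₗ[ℂ] ℂ) : Prop :=
  (∀ a b, ε (a * b) = ε a * ε b) ∧ (∀ a, D.sliceLeft ε a = Multiplier.of a) ∧
    ∀ a, D.sliceRight ε a = Multiplier.of a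

/-- A left integral: a non-zero functional with `(ι ⊗ φ)Δ(a) = φ(a) 1` in `M(A)`. -/
def IsLeftIntegral (φ : A →ₗ[ℂ] ℂ) : Prop :=
  φ ≠ 0 ∧ ∀ a, D.sliceRight φ a = φ a • (1 : Multiplier A)

/-- A bijective linear anti-homomorphism `S : A → A` is an antipode relative to `φ` if
`S((ι ⊗ φ)(Δ(a)(1 ⊗ b))) = (ι ⊗ φ)((1 ⊗ a)Δ(b))`. -/
def IsAntipode (φ : A →ₗ[ℂ] ℂ) (S : A ≃ₗ[ℂ] A) : Prop :=
  (∀ a b, S (a * b) = S b * S a) ∧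
    ∀ a b, S (sliceR φ (D.T₁ a b)) = sliceR φ (D.T₄ a b)

end RegularComultiplication

end Comultiplication

/-- An algebraic quantum hypergroup: an algebra with non-degenerate product and a regular
comultiplication, having a counit and a faithful left integral with an antipode relative to it. The
counit and the antipode are unique and the left integral is unique up to a scalar. -/
structure AlgebraicQuantumHypergroup (A : Type*) [NonUnitalRing A] [Module ℂ A]
    [IsScalarTower ℂ A A] [SMulCommClass ℂ A A] extends RegularComultiplication A where
  counit : A →ₗ[ℂ] ℂ
  isCounit : toRegularComultiplication.IsCounit counit
  integral : A →ₗ[ℂ] ℂ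
  isLeftIntegral : toRegularComultiplication.IsLeftIntegral integral
  isFaithful : IsFaithful integral
  antipode : A ≃ₗ[ℂ] A
  isAntipode : toRegularComultiplication.IsAntipode integral antipode

namespace AlgebraicQuantumHypergroup

variable {A : Type*} [NonUnitalRing A] [Module ℂ A] [IsScalarTower ℂ A A] [SMulCommClass ℂ A A]
variable (H : AlgebraicQuantumHypergroup A)

/-- Compact type: the algebra has an identity. (Then `Δ(1) = 1 ⊗ 1` holds automatically.) -/
def IsCompactType (_H : AlgebraicQuantumHypergroup A) : Prop :=
  ∃ e : A, ∀ a, e * a = a ∧ a * e = a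

/-- A left co-integral: a non-zero element `h` with `a h = ε(a) h` for all `a`. -/
def IsLeftCointegral (h : A) : Prop := h ≠ 0 ∧ ∀ a, a * h = H.counit a • h

/-- Discrete type: there is a left co-integral. -/
def IsDiscreteType : Prop := ∃ h, H.IsLeftCointegral h

end AlgebraicQuantumHypergroup

namespace RegularComultiplication

variable {A : Type*} [NonUnitalRing A] [Module ℂ A] [IsScalarTower ℂ A A] [SMulCommClass ℂ A A]

/-- The functional `ω(· c)`. -/
def fR (ω : A →ₗ[ℂ] ℂ) (c : A) : A →ₗ[ℂ] ℂ := ω ∘ₗ LinearMap.mulRight ℂ c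

/-- The functional `ω(c ·)`. -/
def fL (ω : A →ₗ[ℂ] ℂ) (c : A) : A →ₗ[ℂ] ℂ := ω ∘ₗ LinearMap.mulLeft ℂ c

@[simp] lemma fR_apply (ω : A →ₗ[ℂ] ℂ) (c x : A) : fR ω c x = ω (x * c) := rfl

@[simp] lemma fL_apply (ω : A →ₗ[ℂ] ℂ) (c x : A) : fL ω c x = ω (c * x) := rfl

/-- The span of the functionals `ω(· c)` and `ω(c ·)`. -/
def Cov (A : Type*) [NonUnitalRing A] [Module ℂ A] [IsScalarTower ℂ A A] [SMulCommClass ℂ A A] :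
    Submodule ℂ (A →ₗ[ℂ] ℂ) :=
  Submodule.span ℂ ({ω | ∃ f c, ω = fR f c} ∪ {ω | ∃ f c, ω = fL f c})

lemma fR_mem (ω : A →ₗ[ℂ] ℂ) (c : A) : fR ω c ∈ Cov A :=
  Submodule.subset_span (Or.inl ⟨ω, c, rfl⟩)

lemma fL_mem (ω : A →ₗ[ℂ] ℂ) (c : A) : fL ω c ∈ Cov A :=
  Submodule.subset_span (Or.inr ⟨ω, c, rfl⟩)

lemma cov_induction {p : (A →ₗ[ℂ] ℂ) → Prop} (hR : ∀ f c, p (fR f c)) (hL : ∀ f c, p (fL f c))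
    (hadd : ∀ f g, f ∈ Cov A → g ∈ Cov A → p f → p g → p (f + g))
    (hsmul : ∀ (r : ℂ) f, f ∈ Cov A → p f → p (r • f))
    {ω : A →ₗ[ℂ] ℂ} (hω : ω ∈ Cov A) : p ω := by
  induction hω using Submodule.span_induction with
  | mem x h =>
    rcases h with ⟨f, c, rfl⟩ | ⟨f, c, rfl⟩
    · exact hR f c
    · exact hL f c
  | zero => 
    have := hR 0 0
    rwa [show fR (0 : A →ₗ[ℂ] ℂ) (0 : A) = 0 from rfl] at this
  | add x y hx hy h1 h2 => exact hadd x y hx hy h1 h2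
  | smul r x hx h => exact hsmul r x hx h

lemma eq_of_cov (hA : NondegenerateMul A) {x y : A} (h : ∀ ρ ∈ Cov A, ρ x = ρ y) : x = y := by
  refine sub_eq_zero.1 (hA.1 _ fun c => (Module.forall_dual_apply_eq_zero_iff ℂ _).1 fun f => ?_)
  have := h _ (fR_mem f c)
  simp only [fR_apply] at this
  rw [sub_mul, map_sub, this, sub_self]

lemma sliceL_add' {V W : Type*} [AddCommGroup V] [Module ℂ V] [AddCommGroup W] [Module ℂ W]
    (f g : V →ₗ[ℂ] ℂ) (t : V ⊗[ℂ] W) : sliceL (f + g) t = sliceL f t + sliceL g t := by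
  simp [sliceL, TensorProduct.map_add_left]

lemma sliceL_smul' {V W : Type*} [AddCommGroup V] [Module ℂ V] [AddCommGroup W] [Module ℂ W]
    (r : ℂ) (f : V →ₗ[ℂ] ℂ) (t : V ⊗[ℂ] W) : sliceL (r • f) t = r • sliceL f t := by
  simp [sliceL, TensorProduct.map_smul_left]

lemma sliceR_add' {V W : Type*} [AddCommGroup V] [Module ℂ V] [AddCommGroup W] [Module ℂ W]
    (f g : W →ₗ[ℂ] ℂ) (t : V ⊗[ℂ] W) : sliceR (f + g) t = sliceR f t + sliceR g t := by
  simp [sliceR, TensorProduct.map_add_right]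

lemma sliceR_smul' {V W : Type*} [AddCommGroup V] [Module ℂ V] [AddCommGroup W] [Module ℂ W]
    (r : ℂ) (f : W →ₗ[ℂ] ℂ) (t : V ⊗[ℂ] W) : sliceR (r • f) t = r • sliceR f t := by
  simp [sliceR, TensorProduct.map_smul_right]

variable (D : RegularComultiplication A)

lemma sliceRight_add (f g : A →ₗ[ℂ] ℂ) (x : A) :
    D.sliceRight (f + g) x = D.sliceRight f x + D.sliceRight g x :=
  Multiplier.ext' (fun _ => sliceR_add' f g _) (fun _ => sliceR_add' f g _)

lemma sliceRight_smul (r : ℂ) (f : A →ₗ[ℂ] ℂ) (x : A) :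
    D.sliceRight (r • f) x = r • D.sliceRight f x :=
  Multiplier.ext' (fun _ => sliceR_smul' r f _) (fun _ => sliceR_smul' r f _)

lemma sliceLeft_add (f g : A →ₗ[ℂ] ℂ) (x : A) :
    D.sliceLeft (f + g) x = D.sliceLeft f x + D.sliceLeft g x :=
  Multiplier.ext' (fun _ => sliceL_add' f g _) (fun _ => sliceL_add' f g _)

lemma sliceLeft_smul (r : ℂ) (f : A →ₗ[ℂ] ℂ) (x : A) :
    D.sliceLeft (r • f) x = r • D.sliceLeft f x :=
  Multiplier.ext' (fun _ => sliceL_smul' r f _) (fun _ => sliceL_smul' r f _)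

lemma sliceRight_fR (f : A →ₗ[ℂ] ℂ) (c x : A) :
    Multiplier.of (sliceR f (D.T₁ x c)) = D.sliceRight (fR f c) x :=
  Multiplier.ext_left D.nondegenerate fun d => by
    have := congrArg (sliceR f) (D.R13 x c d)
    rwa [sliceR_map, sliceR_map] at this

lemma sliceRight_fL (f : A →ₗ[ℂ] ℂ) (c x : A) :
    Multiplier.of (sliceR f (D.T₄ c x)) = D.sliceRight (fL f c) x :=
  Multiplier.ext_left D.nondegenerate fun d => by
    have := (congrArg (sliceR f) (D.R34 x d c)).symm
    rwa [sliceR_map, sliceR_map] at this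

lemma sliceLeft_fR (f : A →ₗ[ℂ] ℂ) (c x : A) :
    Multiplier.of (sliceL f (D.T₃ x c)) = D.sliceLeft (fR f c) x :=
  Multiplier.ext_left D.nondegenerate fun d => by
    have := (congrArg (sliceL f) (D.R13 x d c)).symm
    rwa [sliceL_map, sliceL_map] at this

lemma sliceLeft_fL (f : A →ₗ[ℂ] ℂ) (c x : A) :
    Multiplier.of (sliceL f (D.T₂ c x)) = D.sliceLeft (fL f c) x :=
  Multiplier.ext_left D.nondegenerate fun d => by
    have := (congrArg (sliceL f) (D.R12 x d c)).symm
    rwa [sliceL_map, sliceL_map] at this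

open Classical in
/-- The element `(ι ⊗ ω)Δ(x)` of `A` (zero if this multiplier is not in `A`). -/
noncomputable def rA (ω : A →ₗ[ℂ] ℂ) (x : A) : A :=
  if h : ∃ y, Multiplier.of y = D.sliceRight ω x then h.choose else 0

open Classical in
/-- The element `(ω ⊗ ι)Δ(x)` of `A` (zero if this multiplier is not in `A`). -/
noncomputable def lA (x : A) (ω : A →ₗ[ℂ] ℂ) : A :=
  if h : ∃ y, Multiplier.of y = D.sliceLeft ω x then h.choose else 0

lemma of_inj₁ {x y : A} (h : Multiplier.of x = Multiplier.of y) (D : RegularComultiplication A) :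
    x = y :=
  Multiplier.of_injective D.nondegenerate h

lemma rA_eq {ω : A →ₗ[ℂ] ℂ} {x y : A} (h : Multiplier.of y = D.sliceRight ω x) :
    D.rA ω x = y := by
  have h' : ∃ y, Multiplier.of y = D.sliceRight ω x := ⟨y, h⟩
  rw [rA, dif_pos h']
  exact of_inj₁ (h'.choose_spec.trans h.symm) D

lemma lA_eq {ω : A →ₗ[ℂ] ℂ} {x y : A} (h : Multiplier.of y = D.sliceLeft ω x) :
    D.lA x ω = y := by
  have h' : ∃ y, Multiplier.of y = D.sliceLeft ω x := ⟨y, h⟩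
  rw [lA, dif_pos h']
  exact of_inj₁ (h'.choose_spec.trans h.symm) D

lemma of_rA {ω : A →ₗ[ℂ] ℂ} (hω : ω ∈ Cov A) (x : A) :
    Multiplier.of (D.rA ω x) = D.sliceRight ω x := by
  have : ∃ y, Multiplier.of y = D.sliceRight ω x := by
    refine cov_induction (p := fun ω => ∃ y, Multiplier.of y = D.sliceRight ω x)
      (fun f c => ⟨_, D.sliceRight_fR f c x⟩) (fun f c => ⟨_, D.sliceRight_fL f c x⟩) ?_ ?_ hω
    · rintro f g - - ⟨y, hy⟩ ⟨z, hz⟩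
      exact ⟨y + z, by rw [map_add, hy, hz, sliceRight_add]⟩
    · rintro r f - ⟨y, hy⟩
      exact ⟨r • y, by rw [map_smul, hy, sliceRight_smul]⟩
  obtain ⟨y, hy⟩ := this
  rw [D.rA_eq hy, hy]

lemma of_lA {ω : A →ₗ[ℂ] ℂ} (hω : ω ∈ Cov A) (x : A) :
    Multiplier.of (D.lA x ω) = D.sliceLeft ω x := by
  have : ∃ y, Multiplier.of y = D.sliceLeft ω x := by
    refine cov_induction (p := fun ω => ∃ y, Multiplier.of y = D.sliceLeft ω x)
      (fun f c => ⟨_, D.sliceLeft_fR f c x⟩) (fun f c => ⟨_, D.sliceLeft_fL f c x⟩) ?_ ?_ hω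
    · rintro f g - - ⟨y, hy⟩ ⟨z, hz⟩
      exact ⟨y + z, by rw [map_add, hy, hz, sliceLeft_add]⟩
    · rintro r f - ⟨y, hy⟩
      exact ⟨r • y, by rw [map_smul, hy, sliceLeft_smul]⟩
  obtain ⟨y, hy⟩ := this
  rw [D.lA_eq hy, hy]

lemma rA_fR (f : A →ₗ[ℂ] ℂ) (c x : A) : D.rA (fR f c) x = sliceR f (D.T₁ x c) :=
  D.rA_eq (D.sliceRight_fR f c x)

lemma rA_fL (f : A →ₗ[ℂ] ℂ) (c x : A) : D.rA (fL f c) x = sliceR f (D.T₄ c x) :=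
  D.rA_eq (D.sliceRight_fL f c x)

lemma lA_fR (f : A →ₗ[ℂ] ℂ) (c x : A) : D.lA x (fR f c) = sliceL f (D.T₃ x c) :=
  D.lA_eq (D.sliceLeft_fR f c x)

lemma lA_fL (f : A →ₗ[ℂ] ℂ) (c x : A) : D.lA x (fL f c) = sliceL f (D.T₂ c x) :=
  D.lA_eq (D.sliceLeft_fL f c x)

section

variable {ω ρ : A →ₗ[ℂ] ℂ}

lemma rA_mul (hω : ω ∈ Cov A) (x c : A) : D.rA ω x * c = sliceR ω (D.T₃ x c) :=
  congrArg (fun m => Multiplier.left m c) (D.of_rA hω x)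

lemma mul_rA (hω : ω ∈ Cov A) (x c : A) : c * D.rA ω x = sliceR ω (D.T₂ c x) :=
  congrArg (fun m => Multiplier.right m c) (D.of_rA hω x)

lemma lA_mul (hω : ω ∈ Cov A) (x c : A) : D.lA x ω * c = sliceL ω (D.T₁ x c) :=
  congrArg (fun m => Multiplier.left m c) (D.of_lA hω x)

lemma mul_lA (hω : ω ∈ Cov A) (x c : A) : c * D.lA x ω = sliceL ω (D.T₄ c x) :=
  congrArg (fun m => Multiplier.right m c) (D.of_lA hω x)

lemma rA_add (hω : ω ∈ Cov A) (x y : A) : D.rA ω (x + y) = D.rA ω x + D.rA ω y :=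
  eq_of_cov D.nondegenerate fun ρ hρ => by
    refine congrArg ρ (sub_eq_zero.1 (D.nondegenerate.1 _ fun c => ?_))
    rw [sub_mul, add_mul, D.rA_mul hω, D.rA_mul hω, D.rA_mul hω]
    simp

lemma rA_smul (hω : ω ∈ Cov A) (r : ℂ) (x : A) : D.rA ω (r • x) = r • D.rA ω x := by
  refine sub_eq_zero.1 (D.nondegenerate.1 _ fun c => ?_)
  rw [sub_mul, smul_mul_assoc, D.rA_mul hω, D.rA_mul hω]
  simp

lemma lA_add (hω : ω ∈ Cov A) (x y : A) : D.lA (x + y) ω = D.lA x ω + D.lA y ω := by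
  refine sub_eq_zero.1 (D.nondegenerate.1 _ fun c => ?_)
  rw [sub_mul, add_mul, D.lA_mul hω, D.lA_mul hω, D.lA_mul hω]
  simp

lemma lA_smul (hω : ω ∈ Cov A) (r : ℂ) (x : A) : D.lA (r • x) ω = r • D.lA x ω := by
  refine sub_eq_zero.1 (D.nondegenerate.1 _ fun c => ?_)
  rw [sub_mul, smul_mul_assoc, D.lA_mul hω, D.lA_mul hω]
  simp

lemma add_rA (hω : ω ∈ Cov A) (hρ : ρ ∈ Cov A) (x : A) :
    D.rA (ω + ρ) x = D.rA ω x + D.rA ρ x :=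
  D.rA_eq (by rw [map_add, D.of_rA hω, D.of_rA hρ, sliceRight_add])

lemma smul_rA (hω : ω ∈ Cov A) (r : ℂ) (x : A) : D.rA (r • ω) x = r • D.rA ω x :=
  D.rA_eq (by rw [map_smul, D.of_rA hω, sliceRight_smul])

lemma add_lA (hω : ω ∈ Cov A) (hρ : ρ ∈ Cov A) (x : A) :
    D.lA x (ω + ρ) = D.lA x ω + D.lA x ρ :=
  D.lA_eq (by rw [map_add, D.of_lA hω, D.of_lA hρ, sliceLeft_add])

lemma smul_lA (hω : ω ∈ Cov A) (r : ℂ) (x : A) : D.lA x (r • ω) = r • D.lA x ω :=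
  D.lA_eq (by rw [map_smul, D.of_lA hω, sliceLeft_smul])

/-- Both sides are `(ρ ⊗ ω)Δ(x)`. -/
lemma pair (hρ : ρ ∈ Cov A) (hω : ω ∈ Cov A) (x : A) : ρ (D.rA ω x) = ω (D.lA x ρ) := by
  refine cov_induction (p := fun ρ => ρ (D.rA ω x) = ω (D.lA x ρ)) ?_ ?_ ?_ ?_ hρ
  · intro f c
    rw [fR_apply, D.rA_mul hω, D.lA_fR, sliceR_sliceL]
  · intro f c
    rw [fL_apply, D.mul_rA hω, D.lA_fL, sliceR_sliceL]
  · intro f g hf hg h1 h2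
    rw [D.add_lA hf hg, map_add, LinearMap.add_apply, h1, h2]
  · intro r f hf h1
    rw [D.smul_lA hf, map_smul, LinearMap.smul_apply, h1]

lemma comm_aux (f g : A →ₗ[ℂ] ℂ) (c e x : A) :
    sliceR g (D.T₁ (sliceL f (D.T₂ c x)) e) = sliceL f (D.T₂ c (sliceR g (D.T₁ x e))) := by
  have h := congrArg (fun t => sliceR g (sliceL f t)) (D.coassoc c x e)
  simp only [sliceL_map] at h
  rw [show f ∘ₗ LinearMap.id = f from rfl] at h
  refine h.symm.trans ?_
  have h2 : (sliceR g ∘ₗ sliceL f) ∘ₗ (TensorProduct.assoc ℂ A A A).toLinearMap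
      = sliceL f ∘ₗ sliceR g :=
    TensorProduct.ext_threefold fun a b d => by simp [smul_smul, mul_comm]
  have h3 := LinearMap.congr_fun h2 (TensorProduct.map (D.T₂ c) LinearMap.id (D.T₁ x e))
  refine h3.trans ?_
  rw [LinearMap.comp_apply, sliceR_map]
  rfl

lemma comm_aux₂ (f g : A →ₗ[ℂ] ℂ) (c e x : A) :
    sliceR g (D.T₁ (sliceL f (D.T₃ x c)) e) = sliceL f (D.T₃ (sliceR g (D.T₁ x e)) c) := by
  have key : TensorProduct.map LinearMap.id (sliceR g ∘ₗ D.T₁.flip e) (D.T₃ x c)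
      = D.T₃ (sliceR g (D.T₁ x e)) c := by
    refine tensor_cancel₁ D.nondegenerate fun d => sliceL_ext fun f => ?_
    rw [R32, sliceL_map, sliceL_map, sliceL_map]
    have h1 := congrArg (sliceL f) (D.R32 x c d)
    rw [sliceL_map, sliceL_map] at h1
    have h2 := D.comm_aux (fR f c) g d e x
    simp only [LinearMap.id_apply, LinearMap.comp_id] at h1 ⊢
    rw [h1]
    exact h2
  rw [← key, sliceL_map]
  rfl

lemma comm_aux₃ (R : A →ₗ[ℂ] A)
    (h : ∀ g e x, sliceR g (D.T₁ (R x) e) = R (sliceR g (D.T₁ x e))) (g : A →ₗ[ℂ] ℂ) (e x : A) :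
    sliceR g (D.T₄ e (R x)) = R (sliceR g (D.T₄ e x)) := by
  have key : TensorProduct.map R LinearMap.id (D.T₄ e x) = D.T₄ e (R x) := by
    refine tensor_cancel₄ D.nondegenerate fun d => sliceR_ext fun g => ?_
    rw [← R14, sliceR_map, sliceR_map, sliceR_map]
    have h1 := congrArg (sliceR g) (D.R14 x d e)
    rw [sliceR_map, sliceR_map] at h1
    have h2 := h (fL g e) d x
    simp only [LinearMap.id_apply, LinearMap.comp_id] at h1 ⊢
    rw [← h1]
    exact h2.symm
  rw [← key, sliceR_map]
  rfl

/-- Coassociativity. -/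
lemma comm (hω : ω ∈ Cov A) (hρ : ρ ∈ Cov A) (x : A) :
    D.rA ω (D.lA x ρ) = D.lA (D.rA ω x) ρ := by
  refine cov_induction (p := fun ρ => D.rA ω (D.lA x ρ) = D.lA (D.rA ω x) ρ) ?_ ?_ ?_ ?_ hρ
  · intro f c
    refine cov_induction (p := fun ω => D.rA ω (D.lA x (fR f c)) = D.lA (D.rA ω x) (fR f c))
      ?_ ?_ ?_ ?_ hω
    · intro g e
      simp only [rA_fR, lA_fR]
      exact D.comm_aux₂ f g c e x
    · intro g e
      simp only [rA_fL, lA_fR]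
      exact D.comm_aux₃ (sliceL f ∘ₗ D.T₃.flip c) (fun g e x => D.comm_aux₂ f g c e x) g e x
    · intro g g' hg hg' h1 h2
      rw [D.add_rA hg hg', D.add_rA hg hg', D.lA_add (fR_mem f c), h1, h2]
    · intro r g hg h1
      rw [D.smul_rA hg, D.smul_rA hg, D.lA_smul (fR_mem f c), h1]
  · intro f c
    refine cov_induction (p := fun ω => D.rA ω (D.lA x (fL f c)) = D.lA (D.rA ω x) (fL f c))
      ?_ ?_ ?_ ?_ hω
    · intro g e
      simp only [rA_fR, lA_fL]
      exact D.comm_aux f g c e x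
    · intro g e
      simp only [rA_fL, lA_fL]
      exact D.comm_aux₃ (sliceL f ∘ₗ D.T₂ c) (fun g e x => D.comm_aux f g c e x) g e x
    · intro g g' hg hg' h1 h2
      rw [D.add_rA hg hg', D.add_rA hg hg', D.lA_add (fL_mem f c), h1, h2]
    · intro r g hg h1
      rw [D.smul_rA hg, D.smul_rA hg, D.lA_smul (fL_mem f c), h1]
  · intro f g hf hg h1 h2
    rw [D.add_lA hf hg, D.rA_add hω, D.add_lA hf hg, h1, h2]
  · intro r f hf h1
    rw [D.smul_lA hf, D.rA_smul hω, D.smul_lA hf, h1]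

/-- If `η = ωρ` in the convolution sense, then `η` acts as `ω` after `ρ`. -/
lemma rA_rA {η : A →ₗ[ℂ] ℂ} (hω : ω ∈ Cov A) (hρ : ρ ∈ Cov A) (hη : η ∈ Cov A)
    (h : ∀ y, η y = ω (D.rA ρ y)) (x : A) : D.rA ω (D.rA ρ x) = D.rA η x :=
  eq_of_cov D.nondegenerate fun σ hσ => by
    rw [D.pair hσ hω, D.pair hσ hη, ← D.comm hρ hσ, h]

lemma lA_lA {η : A →ₗ[ℂ] ℂ} (hω : ω ∈ Cov A) (hρ : ρ ∈ Cov A) (hη : η ∈ Cov A)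
    (h : ∀ y, η y = ω (D.rA ρ y)) (x : A) : D.lA (D.lA x ω) ρ = D.lA x η :=
  eq_of_cov D.nondegenerate fun σ hσ => by
    rw [← D.pair hρ hσ, ← D.pair hη hσ, D.comm hσ hω, h, D.pair hω hρ]

end

end RegularComultiplication

namespace AlgebraicQuantumHypergroup

open RegularComultiplication

variable {A : Type*} [NonUnitalRing A] [Module ℂ A] [IsScalarTower ℂ A A] [SMulCommClass ℂ A A]
variable (H : AlgebraicQuantumHypergroup A)

lemma S_mul (a b : A) : H.antipode (a * b) = H.antipode b * H.antipode a := H.isAntipode.1 a b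

lemma S_symm_mul (a b : A) :
    H.antipode.symm (a * b) = H.antipode.symm b * H.antipode.symm a := by
  apply H.antipode.injective
  simp [S_mul]

/-- The right integral `ψ = φ ∘ S`. -/
noncomputable def rightIntegral : A →ₗ[ℂ] ℂ := H.integral ∘ₗ H.antipode.toLinearMap

lemma rightIntegral_apply (a : A) : H.rightIntegral a = H.integral (H.antipode a) := rfl

lemma counit_rA {ω : A →ₗ[ℂ] ℂ} (hω : ω ∈ Cov A) (x : A) : H.counit (H.rA ω x) = ω x := by
  have key := H.isCounit.2.1 x
  refine cov_induction (p := fun ω => H.counit (H.rA ω x) = ω x) ?_ ?_ ?_ ?_ hω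
  · intro f c
    rw [rA_fR, sliceR_sliceL]
    exact congrArg f (congrArg (fun m => Multiplier.left m c) key)
  · intro f c
    rw [rA_fL, sliceR_sliceL]
    exact congrArg f (congrArg (fun m => Multiplier.right m c) key)
  · intro f g hf hg h1 h2
    rw [H.add_rA hf hg, map_add, h1, h2, LinearMap.add_apply]
  · intro r f hf h1
    rw [H.smul_rA hf, map_smul, h1, LinearMap.smul_apply]

lemma counit_lA {ω : A →ₗ[ℂ] ℂ} (hω : ω ∈ Cov A) (x : A) : H.counit (H.lA x ω) = ω x := by
  have key := H.isCounit.2.2 x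
  refine cov_induction (p := fun ω => H.counit (H.lA x ω) = ω x) ?_ ?_ ?_ ?_ hω
  · intro f c
    rw [lA_fR, ← sliceR_sliceL]
    exact congrArg f (congrArg (fun m => Multiplier.left m c) key)
  · intro f c
    rw [lA_fL, ← sliceR_sliceL]
    exact congrArg f (congrArg (fun m => Multiplier.right m c) key)
  · intro f g hf hg h1 h2
    rw [H.add_lA hf hg, map_add, h1, h2, LinearMap.add_apply]
  · intro r f hf h1
    rw [H.smul_lA hf, map_smul, h1, LinearMap.smul_apply]

lemma integral_lA_fR (f : A →ₗ[ℂ] ℂ) (c x : A) :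
    H.integral (H.lA x (fR f c)) = f c * H.integral x := by
  have key := congrArg (fun m => Multiplier.left m c) (H.isLeftIntegral.2 x)
  rw [lA_fR, ← sliceR_sliceL]
  refine (congrArg f key).trans ?_
  simp [mul_comm]

lemma integral_lA_fL (f : A →ₗ[ℂ] ℂ) (c x : A) :
    H.integral (H.lA x (fL f c)) = f c * H.integral x := by
  have key := congrArg (fun m => Multiplier.right m c) (H.isLeftIntegral.2 x)
  rw [lA_fL, ← sliceR_sliceL]
  refine (congrArg f key).trans ?_
  simp [mul_comm]

lemma exists_integral_ne : ∃ x, H.integral x ≠ 0 := by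
  by_contra! h
  exact H.isLeftIntegral.1 (LinearMap.ext h)

lemma exists_counit_ne : ∃ x, H.counit x ≠ 0 := by
  by_contra! h
  obtain ⟨x, hx⟩ := H.exists_integral_ne
  refine hx ?_
  rw [show x = 0 from H.nondegenerate.1 _ fun c => ?_, map_zero]
  have key := congrArg (fun m => Multiplier.left m c) (H.isCounit.2.1 x)
  refine key.symm.trans ?_
  rw [show H.counit = 0 from LinearMap.ext h]
  simp [sliceLeft, sliceL]

lemma sliceR_counit_T₁ (a b : A) : sliceR H.counit (H.T₁ a b) = H.counit b • a := by
  refine sub_eq_zero.1 (H.nondegenerate.1 _ fun c => ?_)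
  have h1 := congrArg (sliceR H.counit) (H.R13 a b c)
  rw [sliceR_map, sliceR_map] at h1
  have h2 : H.counit ∘ₗ LinearMap.mulRight ℂ b = H.counit b • H.counit :=
    LinearMap.ext fun x => by simp [H.isCounit.1, mul_comm]
  have h3 : sliceR H.counit (H.T₃ a c) = a * c :=
    congrArg (fun m => Multiplier.left m c) (H.isCounit.2.2 a)
  rw [h2, sliceR_smul', h3] at h1
  rw [sub_mul, smul_mul_assoc]
  exact sub_eq_zero.2 h1

lemma sliceR_counit_T₄ (a b : A) : sliceR H.counit (H.T₄ b a) = H.counit b • a := by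
  refine sub_eq_zero.1 (H.nondegenerate.1 _ fun c => ?_)
  have h1 := (congrArg (sliceR H.counit) (H.R34 a c b)).symm
  rw [sliceR_map, sliceR_map] at h1
  have h2 : H.counit ∘ₗ LinearMap.mulLeft ℂ b = H.counit b • H.counit :=
    LinearMap.ext fun x => by simp [H.isCounit.1]
  have h3 : sliceR H.counit (H.T₃ a c) = a * c :=
    congrArg (fun m => Multiplier.left m c) (H.isCounit.2.2 a)
  rw [h2, sliceR_smul', h3] at h1
  rw [sub_mul, smul_mul_assoc]
  exact sub_eq_zero.2 h1

lemma sliceL_counit_T₃ (a b : A) : sliceL H.counit (H.T₃ a b) = H.counit b • a := by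
  refine sub_eq_zero.1 (H.nondegenerate.1 _ fun c => ?_)
  have h1 := (congrArg (sliceL H.counit) (H.R13 a c b)).symm
  rw [sliceL_map, sliceL_map] at h1
  have h2 : H.counit ∘ₗ LinearMap.mulRight ℂ b = H.counit b • H.counit :=
    LinearMap.ext fun x => by simp [H.isCounit.1, mul_comm]
  have h3 : sliceL H.counit (H.T₁ a c) = a * c :=
    congrArg (fun m => Multiplier.left m c) (H.isCounit.2.1 a)
  rw [h2, sliceL_smul', h3] at h1
  rw [sub_mul, smul_mul_assoc]
  exact sub_eq_zero.2 h1

lemma eq_zero_of_counit_smul {a : A} {f : A →ₗ[ℂ] ℂ} (h : ∀ b, f (H.counit b • a) = 0) :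
    f a = 0 := by
  obtain ⟨b, hb⟩ := H.exists_counit_ne
  have := h b
  rw [map_smul, smul_eq_mul] at this
  exact (mul_eq_zero.1 this).resolve_left hb

lemma exists_rA_fR {f : A →ₗ[ℂ] ℂ} (hf : IsFaithful f) (a : A) : ∃ e, H.rA (fR f e) a = a := by
  by_contra! h
  have : a ∉ LinearMap.range (sliceR f ∘ₗ H.T₁ a) := by
    rintro ⟨e, he⟩
    exact h e ((H.rA_fR f e a).trans he)
  obtain ⟨ω, hω, hV⟩ := Submodule.exists_le_ker_of_notMem this
  refine hω (H.eq_zero_of_counit_smul fun b => ?_)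
  have hz : sliceL ω (H.T₁ a b) = 0 := hf.1 _ fun c => by
    have h1 : ω (sliceR f (H.T₁ a (b * c))) = 0 := hV ⟨b * c, rfl⟩
    rw [sliceR_sliceL, R11, sliceL_map] at h1
    exact h1
  rw [← sliceR_counit_T₁, sliceR_sliceL, hz, map_zero]

lemma exists_rA_fL {f : A →ₗ[ℂ] ℂ} (hf : IsFaithful f) (a : A) : ∃ e, H.rA (fL f e) a = a := by
  by_contra! h
  have : a ∉ LinearMap.range (sliceR f ∘ₗ H.T₄.flip a) := by
    rintro ⟨e, he⟩
    exact h e ((H.rA_fL f e a).trans he)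
  obtain ⟨ω, hω, hV⟩ := Submodule.exists_le_ker_of_notMem this
  refine hω (H.eq_zero_of_counit_smul fun b => ?_)
  have hz : sliceL ω (H.T₄ b a) = 0 := hf.2 _ fun c => by
    have h1 : ω (sliceR f (H.T₄ (c * b) a)) = 0 := hV ⟨c * b, rfl⟩
    rw [sliceR_sliceL, R44, sliceL_map] at h1
    exact h1
  rw [← sliceR_counit_T₄, sliceR_sliceL, hz, map_zero]

lemma exists_lA_fR {f : A →ₗ[ℂ] ℂ} (hf : IsFaithful f) (a : A) : ∃ e, H.lA a (fR f e) = a := by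
  by_contra! h
  have : a ∉ LinearMap.range (sliceL f ∘ₗ H.T₃ a) := by
    rintro ⟨e, he⟩
    exact h e ((H.lA_fR f e a).trans he)
  obtain ⟨ω, hω, hV⟩ := Submodule.exists_le_ker_of_notMem this
  refine hω (H.eq_zero_of_counit_smul fun b => ?_)
  have hz : sliceR ω (H.T₃ a b) = 0 := hf.1 _ fun c => by
    have h1 : ω (sliceL f (H.T₃ a (b * c))) = 0 := hV ⟨b * c, rfl⟩
    rw [← sliceR_sliceL, R33, sliceR_map] at h1
    exact h1
  rw [← sliceL_counit_T₃, ← sliceR_sliceL, hz, map_zero]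

lemma cov_S {ω : A →ₗ[ℂ] ℂ} (hω : ω ∈ Cov A) : ω ∘ₗ H.antipode.toLinearMap ∈ Cov A := by
  refine cov_induction (p := fun ω => ω ∘ₗ H.antipode.toLinearMap ∈ Cov A) ?_ ?_ ?_ ?_ hω
  · intro f c
    have : fR f c ∘ₗ H.antipode.toLinearMap
        = fL (f ∘ₗ H.antipode.toLinearMap) (H.antipode.symm c) :=
      LinearMap.ext fun x => by simp [S_mul]
    rw [this]; exact fL_mem _ _
  · intro f c
    have : fL f c ∘ₗ H.antipode.toLinearMap
        = fR (f ∘ₗ H.antipode.toLinearMap) (H.antipode.symm c) :=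
      LinearMap.ext fun x => by simp [S_mul]
    rw [this]; exact fR_mem _ _
  · intro f g _ _ h1 h2
    rw [LinearMap.add_comp]; exact Submodule.add_mem _ h1 h2
  · intro r f _ h1
    rw [LinearMap.smul_comp]; exact Submodule.smul_mem _ _ h1

lemma cov_S_symm {ω : A →ₗ[ℂ] ℂ} (hω : ω ∈ Cov A) :
    ω ∘ₗ H.antipode.symm.toLinearMap ∈ Cov A := by
  refine cov_induction (p := fun ω => ω ∘ₗ H.antipode.symm.toLinearMap ∈ Cov A) ?_ ?_ ?_ ?_ hω
  · intro f c
    have : fR f c ∘ₗ H.antipode.symm.toLinearMap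
        = fL (f ∘ₗ H.antipode.symm.toLinearMap) (H.antipode c) :=
      LinearMap.ext fun x => by simp [S_symm_mul]
    rw [this]; exact fL_mem _ _
  · intro f c
    have : fL f c ∘ₗ H.antipode.symm.toLinearMap
        = fR (f ∘ₗ H.antipode.symm.toLinearMap) (H.antipode c) :=
      LinearMap.ext fun x => by simp [S_symm_mul]
    rw [this]; exact fR_mem _ _
  · intro f g _ _ h1 h2
    rw [LinearMap.add_comp]; exact Submodule.add_mem _ h1 h2
  · intro r f _ h1
    rw [LinearMap.smul_comp]; exact Submodule.smul_mem _ _ h1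

lemma antipode_rA (a b : A) :
    H.antipode (H.rA (fR H.integral b) a) = H.rA (fL H.integral a) b := by
  rw [rA_fR, rA_fL]
  exact H.isAntipode.2 a b

/-- The product `ω φ(a ·)` is `φ(((ω ∘ S) ⊗ ι)Δ(a) ·)`. -/
lemma apply_rA_fL {ω : A →ₗ[ℂ] ℂ} (hω : ω ∈ Cov A) (a y : A) :
    ω (H.rA (fL H.integral a) y)
      = H.integral (H.lA a (ω ∘ₗ H.antipode.toLinearMap) * y) := by
  rw [← antipode_rA]
  exact H.pair (H.cov_S hω) (fR_mem H.integral y) a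

/-- The product `ω φ(· a)` is `φ(· ((ω ∘ S⁻¹) ⊗ ι)Δ(a))`. -/
lemma apply_rA_fR {ω : A →ₗ[ℂ] ℂ} (hω : ω ∈ Cov A) (a y : A) :
    ω (H.rA (fR H.integral a) y)
      = H.integral (y * H.lA a (ω ∘ₗ H.antipode.symm.toLinearMap)) := by
  have h := H.pair (H.cov_S_symm hω) (fL_mem H.integral y) a
  rw [← antipode_rA] at h
  simpa using h

/-- `S` flips the coproduct. -/
lemma antipode_lA {ω : A →ₗ[ℂ] ℂ} (hω : ω ∈ Cov A) (x : A) :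
    H.antipode (H.lA x (ω ∘ₗ H.antipode.toLinearMap)) = H.rA ω (H.antipode x) := by
  obtain ⟨e, he⟩ := H.exists_rA_fR H.isFaithful x
  have h1 : H.antipode x = H.rA (fL H.integral x) e := by rw [← antipode_rA, he]
  rw [h1, H.rA_rA hω (fL_mem _ _)
    (fL_mem H.integral (H.lA x (ω ∘ₗ H.antipode.toLinearMap)))
    (fun y => (H.apply_rA_fL hω x y).symm), ← antipode_rA, H.comm (fR_mem _ _) (H.cov_S hω), he]

/-- The antipode property in terms of the right integral. -/
lemma antipode_rightIntegral (a b : A) :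
    H.antipode (H.lA a (fL H.rightIntegral b)) = H.lA b (fR H.rightIntegral a) := by
  apply H.antipode.injective
  have h1 : fL H.rightIntegral b
      = fR H.integral (H.antipode b) ∘ₗ H.antipode.toLinearMap :=
    LinearMap.ext fun x => by simp [rightIntegral_apply, S_mul]
  have h2 : fR H.rightIntegral a
      = fL H.integral (H.antipode a) ∘ₗ H.antipode.toLinearMap :=
    LinearMap.ext fun x => by simp [rightIntegral_apply, S_mul]
  rw [h1, h2, antipode_lA _ (fR_mem _ _), antipode_lA _ (fL_mem _ _), antipode_rA]

/-- The product `ψ(a ·) ω` is `ψ((ι ⊗ (ω ∘ S⁻¹))Δ(a) ·)`. -/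
lemma apply_lA_fL {ω : A →ₗ[ℂ] ℂ} (hω : ω ∈ Cov A) (a y : A) :
    ω (H.lA y (fL H.rightIntegral a))
      = H.rightIntegral (H.rA (ω ∘ₗ H.antipode.symm.toLinearMap) a * y) := by
  have h := H.pair (fR_mem H.rightIntegral y) (H.cov_S_symm hω) a
  rw [← antipode_rightIntegral] at h
  simpa using h.symm

lemma isFaithful_S {f : A →ₗ[ℂ] ℂ} (hf : IsFaithful f) :
    IsFaithful (f ∘ₗ H.antipode.toLinearMap) := by
  refine ⟨fun x h => H.antipode.injective ?_, fun x h => H.antipode.injective ?_⟩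
  · rw [map_zero]
    refine hf.2 _ fun y => ?_
    have := h (H.antipode.symm y)
    simpa [S_mul] using this
  · rw [map_zero]
    refine hf.1 _ fun y => ?_
    have := h (H.antipode.symm y)
    simpa [S_mul] using this

lemma isFaithful_S_symm {f : A →ₗ[ℂ] ℂ} (hf : IsFaithful f) :
    IsFaithful (f ∘ₗ H.antipode.symm.toLinearMap) := by
  refine ⟨fun x h => H.antipode.symm.injective ?_, fun x h => H.antipode.symm.injective ?_⟩
  · rw [map_zero]
    refine hf.2 _ fun y => ?_
    have := h (H.antipode y)
    simpa [S_symm_mul] using this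
  · rw [map_zero]
    refine hf.1 _ fun y => ?_
    have := h (H.antipode y)
    simpa [S_symm_mul] using this

lemma isFaithful_rightIntegral : IsFaithful H.rightIntegral := H.isFaithful_S H.isFaithful

/-- The underlying space of the dual: all functionals of the form `φ(· a)`. -/
def dualSpace : Submodule ℂ (A →ₗ[ℂ] ℂ) where
  carrier := {ω | ∃ a, ω = fR H.integral a}
  add_mem' := by
    rintro _ _ ⟨a, rfl⟩ ⟨b, rfl⟩
    exact ⟨a + b, LinearMap.ext fun x => by simp [mul_add]⟩
  zero_mem' := ⟨0, LinearMap.ext fun x => by simp⟩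
  smul_mem' := by
    rintro r _ ⟨a, rfl⟩
    exact ⟨r • a, LinearMap.ext fun x => by simp [mul_smul_comm]⟩

lemma dual_cov {ω : A →ₗ[ℂ] ℂ} (h : ω ∈ H.dualSpace) : ω ∈ Cov A := by
  obtain ⟨a, rfl⟩ := h
  exact fR_mem _ _

lemma mem_fR (a : A) : fR H.integral a ∈ H.dualSpace := ⟨a, rfl⟩

lemma mem_ψL (a : A) : fL H.rightIntegral a ∈ H.dualSpace := by
  obtain ⟨e, he⟩ := H.exists_rA_fL (H.isFaithful_S_symm H.isFaithful) a
  have h1 : fL (H.integral ∘ₗ H.antipode.symm.toLinearMap) e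
      = fR H.integral (H.antipode.symm e) ∘ₗ H.antipode.symm.toLinearMap :=
    LinearMap.ext fun x => by simp [S_symm_mul]
  refine ⟨H.lA (H.antipode.symm e) (fL H.rightIntegral a ∘ₗ H.antipode.symm.toLinearMap),
    LinearMap.ext fun x => ?_⟩
  rw [fR_apply, ← H.apply_rA_fR (fL_mem _ _), H.pair (fL_mem _ _) (fR_mem _ _),
    H.apply_lA_fL (fR_mem _ _), ← h1, he]
  rfl

lemma ex_ψL {ω : A →ₗ[ℂ] ℂ} (h : ω ∈ H.dualSpace) : ∃ a, ω = fL H.rightIntegral a := by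
  obtain ⟨b, rfl⟩ := h
  obtain ⟨e, he⟩ := H.exists_lA_fR H.isFaithful b
  have h1 : fL H.rightIntegral (H.antipode.symm e) ∘ₗ H.antipode.symm.toLinearMap
      = fR H.integral e :=
    LinearMap.ext fun x => by simp [rightIntegral_apply, S_mul]
  refine ⟨H.rA (fR H.integral b ∘ₗ H.antipode.symm.toLinearMap) (H.antipode.symm e),
    LinearMap.ext fun x => ?_⟩
  rw [fL_apply, ← H.apply_lA_fL (fR_mem _ _), ← H.pair (fL_mem _ _) (fR_mem _ _),
    H.apply_rA_fR (fL_mem _ _), h1, he]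
  rfl

lemma mem_φL (a : A) : fL H.integral a ∈ H.dualSpace := by
  obtain ⟨e, he⟩ := H.exists_lA_fR (H.isFaithful_S (H.isFaithful_S H.isFaithful)) a
  have h1 : fL H.rightIntegral (H.antipode e) ∘ₗ H.antipode.toLinearMap
      = fR ((H.integral ∘ₗ H.antipode.toLinearMap) ∘ₗ H.antipode.toLinearMap) e :=
    LinearMap.ext fun x => by simp [rightIntegral_apply, S_mul]
  have h2 : fL H.integral a = fL H.rightIntegral
      (H.rA (fL H.integral a ∘ₗ H.antipode.symm.toLinearMap) (H.antipode e)) := by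
    refine LinearMap.ext fun x => ?_
    rw [fL_apply H.rightIntegral, ← H.apply_lA_fL (fL_mem _ _), ← H.pair (fL_mem _ _) (fL_mem _ _),
      H.apply_rA_fL (fL_mem _ _), h1, he]
    rfl
  rw [h2]
  exact H.mem_ψL _

lemma ex_φL {ω : A →ₗ[ℂ] ℂ} (h : ω ∈ H.dualSpace) : ∃ a, ω = fL H.integral a := by
  obtain ⟨a, rfl⟩ := H.ex_ψL h
  obtain ⟨e, he⟩ := H.exists_rA_fR (H.isFaithful_S_symm H.isFaithful) a
  have h1 : fR (H.integral ∘ₗ H.antipode.symm.toLinearMap) e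
      = fL H.integral (H.antipode.symm e) ∘ₗ H.antipode.symm.toLinearMap :=
    LinearMap.ext fun x => by simp [S_symm_mul]
  refine ⟨H.lA (H.antipode.symm e) (fL H.rightIntegral a ∘ₗ H.antipode.toLinearMap),
    LinearMap.ext fun x => ?_⟩
  rw [fL_apply H.integral, ← H.apply_rA_fL (fL_mem _ _), H.pair (fL_mem _ _) (fL_mem _ _),
    H.apply_lA_fL (fL_mem _ _), ← h1, he]
  rfl

lemma mem_S {ω : A →ₗ[ℂ] ℂ} (h : ω ∈ H.dualSpace) :
    ω ∘ₗ H.antipode.toLinearMap ∈ H.dualSpace := by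
  obtain ⟨a, rfl⟩ := h
  have : fR H.integral a ∘ₗ H.antipode.toLinearMap
      = fL H.rightIntegral (H.antipode.symm a) :=
    LinearMap.ext fun x => by simp [rightIntegral_apply, S_mul]
  rw [this]
  exact H.mem_ψL _

lemma mem_S_symm {ω : A →ₗ[ℂ] ℂ} (h : ω ∈ H.dualSpace) :
    ω ∘ₗ H.antipode.symm.toLinearMap ∈ H.dualSpace := by
  obtain ⟨a, rfl⟩ := H.ex_ψL h
  exact ⟨H.antipode a, LinearMap.ext fun x => by simp [rightIntegral_apply, S_mul]⟩

lemma ex_ψR {ω : A →ₗ[ℂ] ℂ} (h : ω ∈ H.dualSpace) : ∃ a, ω = fR H.rightIntegral a := by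
  obtain ⟨a, ha⟩ := H.ex_φL (H.mem_S_symm h)
  refine ⟨H.antipode.symm a, LinearMap.ext fun x => ?_⟩
  have := LinearMap.congr_fun ha (H.antipode x)
  simpa [rightIntegral_apply, S_mul] using this

lemma mem_ψR (a : A) : fR H.rightIntegral a ∈ H.dualSpace := by
  have : fR H.rightIntegral a = fL H.integral (H.antipode a) ∘ₗ H.antipode.toLinearMap :=
    LinearMap.ext fun x => by simp [rightIntegral_apply, S_mul]
  rw [this]
  exact H.mem_S (H.mem_φL _)

lemma mem_fL_dual {ω : A →ₗ[ℂ] ℂ} (h : ω ∈ H.dualSpace) (a : A) : fL ω a ∈ H.dualSpace := by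
  obtain ⟨b, rfl⟩ := H.ex_ψL h
  rw [show fL (fL H.rightIntegral b) a = fL H.rightIntegral (b * a) from
    LinearMap.ext fun x => by simp [mul_assoc]]
  exact H.mem_ψL _

lemma eq_of_dual {x y : A} (h : ∀ ω ∈ H.dualSpace, ω x = ω y) : x = y := by
  refine sub_eq_zero.1 (H.isFaithful.1 _ fun c => ?_)
  have := h _ (H.mem_fR c)
  simp only [fR_apply] at this
  rw [sub_mul, map_sub, this, sub_self]

end AlgebraicQuantumHypergroup

namespace AlgebraicQuantumHypergroup

open RegularComultiplication

variable {A : Type*} [NonUnitalRing A] [Module ℂ A] [IsScalarTower ℂ A A] [SMulCommClass ℂ A A]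
variable (H : AlgebraicQuantumHypergroup A)

/-- The dual of `A`, as a vector space: functionals of the form `φ(· a)`. -/
abbrev Dual : Type _ := ↥(H.dualSpace)

lemma cov (ω : H.Dual) : ω.1 ∈ Cov A := H.dual_cov ω.2

/-- The linear isomorphism `a ↦ φ(· a)`. -/
noncomputable def hat : A ≃ₗ[ℂ] H.Dual :=
  LinearEquiv.ofBijective
    { toFun := fun a => ⟨fR H.integral a, H.mem_fR a⟩
      map_add' := fun a b => Subtype.ext (LinearMap.ext fun x => by simp [mul_add])
      map_smul' := fun r a => Subtype.ext (LinearMap.ext fun x => by simp [mul_smul_comm]) }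
    ⟨fun a b h => sub_eq_zero.1 (H.isFaithful.2 _ fun y => by
        have := LinearMap.congr_fun (congrArg Subtype.val h) y
        simp only [LinearMap.coe_mk, AddHom.coe_mk, fR_apply] at this
        rw [mul_sub, map_sub, this, sub_self]),
      fun ω => by
        obtain ⟨a, ha⟩ := ω.2
        exact ⟨a, Subtype.ext ha.symm⟩⟩

lemma hat_symm_spec (ω : H.Dual) : fR H.integral (H.hat.symm ω) = ω.1 :=
  congrArg Subtype.val (H.hat.apply_symm_apply ω)

/-- The linear isomorphism `a ↦ ψ(a ·)`. -/
noncomputable def hatψ : A ≃ₗ[ℂ] H.Dual :=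
  LinearEquiv.ofBijective
    { toFun := fun a => ⟨fL H.rightIntegral a, H.mem_ψL a⟩
      map_add' := fun a b => Subtype.ext (LinearMap.ext fun x => by simp [add_mul])
      map_smul' := fun r a => Subtype.ext (LinearMap.ext fun x => by simp [smul_mul_assoc]) }
    ⟨fun a b h => sub_eq_zero.1 (H.isFaithful_rightIntegral.1 _ fun y => by
        have := LinearMap.congr_fun (congrArg Subtype.val h) y
        simp only [LinearMap.coe_mk, AddHom.coe_mk, fL_apply] at this
        rw [sub_mul, map_sub, this, sub_self]),
      fun ω => by
        obtain ⟨a, ha⟩ := H.ex_ψL ω.2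
        exact ⟨a, Subtype.ext ha.symm⟩⟩

/-- The action `(ι ⊗ ω)Δ(x)` of the dual on `A`: for `ω = φ(· a)` it is
`(ι ⊗ φ)(Δ(x)(1 ⊗ a))`. -/
noncomputable def actR : H.Dual →ₗ[ℂ] A →ₗ[ℂ] A :=
  (H.T₁.flip.compr₂ (sliceR H.integral)) ∘ₗ H.hat.symm.toLinearMap

/-- The action `(ω ⊗ ι)Δ(x)` of the dual on `A`: for `ω = φ(· a)` it is
`(φ ⊗ ι)(Δ(x)(a ⊗ 1))`. -/
noncomputable def actL : H.Dual →ₗ[ℂ] A →ₗ[ℂ] A :=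
  (H.T₃.flip.compr₂ (sliceL H.integral)) ∘ₗ H.hat.symm.toLinearMap

lemma actR_eq (ω : H.Dual) (x : A) : H.actR ω x = H.rA ω.1 x := by
  conv_rhs => rw [← hat_symm_spec, rA_fR]
  rfl

lemma actL_eq (ω : H.Dual) (x : A) : H.actL ω x = H.lA x ω.1 := by
  conv_rhs => rw [← hat_symm_spec, lA_fR]
  rfl

lemma mul_mem (ω ρ : H.Dual) : ω.1 ∘ₗ H.actR ρ ∈ H.dualSpace :=
  ⟨H.lA (H.hat.symm ρ) (ω.1 ∘ₗ H.antipode.symm.toLinearMap), LinearMap.ext fun x => by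
    rw [LinearMap.comp_apply, actR_eq, ← hat_symm_spec H ρ, H.apply_rA_fR (H.cov ω)]
    rfl⟩

/-- The product of the dual: `(ωρ)(x) = (ω ⊗ ρ)Δ(x) = ω((ι ⊗ ρ)Δ(x))`. -/
noncomputable instance : Mul H.Dual := ⟨fun ω ρ => ⟨ω.1 ∘ₗ H.actR ρ, H.mul_mem ω ρ⟩⟩

lemma mul_apply (ω ρ : H.Dual) (x : A) : (ω * ρ).1 x = ω.1 (H.actR ρ x) := rfl

lemma mul_apply' (ω ρ : H.Dual) (x : A) : (ω * ρ).1 x = ρ.1 (H.actL ω x) := by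
  rw [mul_apply, actR_eq, actL_eq, H.pair (H.cov ω) (H.cov ρ)]

lemma actR_mul (ω ρ : H.Dual) (x : A) : H.actR (ω * ρ) x = H.actR ω (H.actR ρ x) := by
  rw [actR_eq, actR_eq, actR_eq]
  exact (H.rA_rA (H.cov ω) (H.cov ρ) (H.cov (ω * ρ))
    (fun y => by rw [mul_apply, actR_eq]) x).symm

lemma actL_mul (ω ρ : H.Dual) (x : A) : H.actL (ω * ρ) x = H.actL ρ (H.actL ω x) := by
  rw [actL_eq, actL_eq, actL_eq]
  exact (H.lA_lA (H.cov ω) (H.cov ρ) (H.cov (ω * ρ))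
    (fun y => by rw [mul_apply, actR_eq]) x).symm

lemma act_comm (ω ρ : H.Dual) (x : A) : H.actR ω (H.actL ρ x) = H.actL ρ (H.actR ω x) := by
  simp only [actR_eq, actL_eq]
  exact H.comm (H.cov ω) (H.cov ρ) x

lemma dual_ext {ω ρ : H.Dual} (h : ∀ x, ω.1 x = ρ.1 x) : ω = ρ :=
  Subtype.ext (LinearMap.ext h)

noncomputable instance : NonUnitalRing H.Dual where
  left_distrib ω ρ σ := H.dual_ext fun x => by
    simp [mul_apply]
  right_distrib ω ρ σ := H.dual_ext fun x => by
    simp [mul_apply]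
  zero_mul ω := H.dual_ext fun x => by simp [mul_apply]
  mul_zero ω := H.dual_ext fun x => by simp [mul_apply]
  mul_assoc ω ρ σ := H.dual_ext fun x => by
    simp [mul_apply, actR_mul]

instance : IsScalarTower ℂ H.Dual H.Dual :=
  ⟨fun r ω ρ => H.dual_ext fun x => by simp [mul_apply]⟩

instance : SMulCommClass ℂ H.Dual H.Dual :=
  ⟨fun r ω ρ => H.dual_ext fun x => by simp [mul_apply]⟩

lemma counit_actR (ω : H.Dual) (x : A) : H.counit (H.actR ω x) = ω.1 x := by
  rw [actR_eq, H.counit_rA (H.cov ω)]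

lemma eq_of_dual' {x y : A} (h : ∀ ω : H.Dual, ω.1 x = ω.1 y) : x = y :=
  H.eq_of_dual fun ω hω => h ⟨ω, hω⟩

lemma dual_nondegenerate : NondegenerateMul H.Dual := by
  constructor
  · intro ω h
    refine H.dual_ext fun x => ?_
    obtain ⟨e, he⟩ := H.exists_rA_fR H.isFaithful x
    have h1 := congrArg (fun η : H.Dual => η.1 x) (h ⟨fR H.integral e, H.mem_fR e⟩)
    simpa only [mul_apply, actR_eq, he] using h1
  · intro ρ h
    refine H.dual_ext fun x => ?_
    have h1 : H.actR ρ x = 0 := H.eq_of_dual' fun ω => by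
      rw [← mul_apply, h]
      simp
    have h2 := H.counit_actR ρ x
    rw [h1, map_zero] at h2
    exact h2.symm

/-- Evaluation at `x`, as a functional on the dual. -/
def ev (x : A) : H.Dual →ₗ[ℂ] ℂ := LinearMap.applyₗ x ∘ₗ H.dualSpace.subtype

lemma ev_apply (x : A) (ω : H.Dual) : H.ev x ω = ω.1 x := rfl

/-- The pairing of `Â ⊗ Â` with `A ⊗ A`. -/
noncomputable def pairing : H.Dual ⊗[ℂ] H.Dual →ₗ[ℂ] (A ⊗[ℂ] A →ₗ[ℂ] ℂ) :=
  TensorProduct.dualDistrib ℂ A A ∘ₗ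
    TensorProduct.map H.dualSpace.subtype H.dualSpace.subtype

@[simp] lemma pairing_tmul (ω ρ : H.Dual) (x y : A) :
    H.pairing (ω ⊗ₜ ρ) (x ⊗ₜ y) = ω.1 x * ρ.1 y := by
  simp [pairing]

lemma sliceL_ev (t : H.Dual ⊗[ℂ] H.Dual) (x y : A) :
    (sliceL (H.ev x) t).1 y = H.pairing t (x ⊗ₜ y) := by
  induction t with
  | zero => simp
  | add t u ht hu =>
    rw [map_add, map_add, LinearMap.add_apply, ← ht, ← hu]; rfl
  | tmul ω ρ => simp [ev_apply]

lemma sliceR_ev (t : H.Dual ⊗[ℂ] H.Dual) (x y : A) :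
    (sliceR (H.ev y) t).1 x = H.pairing t (x ⊗ₜ y) := by
  induction t with
  | zero => simp
  | add t u ht hu =>
    rw [map_add, map_add, LinearMap.add_apply, ← ht, ← hu]; rfl
  | tmul ω ρ => simp [ev_apply, mul_comm]

lemma tensor_ext_ev {W : Type*} [AddCommGroup W] [Module ℂ W] {t u : H.Dual ⊗[ℂ] W}
    (h : ∀ x, sliceL (H.ev x) t = sliceL (H.ev x) u) : t = u := by
  refine sliceR_ext fun g => H.dual_ext fun x => ?_
  rw [← ev_apply, ← ev_apply, sliceR_sliceL, sliceR_sliceL, h]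

lemma pairing_injective : Function.Injective H.pairing := by
  intro t u h
  refine H.tensor_ext_ev fun x => H.dual_ext fun y => ?_
  rw [sliceL_ev, sliceL_ev, h]

lemma pairing_ext {t u : H.Dual ⊗[ℂ] H.Dual}
    (h : ∀ x y, H.pairing t (x ⊗ₜ y) = H.pairing u (x ⊗ₜ y)) : t = u :=
  H.pairing_injective (TensorProduct.ext' h)

/-- The action `z ↦ t ▸ z` of `Â ⊗ Â` on `A ⊗ A`, factorwise `x ↦ (ι ⊗ ω)Δ(x)`. -/
noncomputable def actR₂ : H.Dual ⊗[ℂ] H.Dual →ₗ[ℂ] A ⊗[ℂ] A →ₗ[ℂ] A ⊗[ℂ] A :=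
  TensorProduct.homTensorHomMap (RingHom.id ℂ) A A A A ∘ₗ TensorProduct.map H.actR H.actR

/-- The action of `Â ⊗ Â` on `A ⊗ A`, factorwise `x ↦ (ω ⊗ ι)Δ(x)`. -/
noncomputable def actL₂ : H.Dual ⊗[ℂ] H.Dual →ₗ[ℂ] A ⊗[ℂ] A →ₗ[ℂ] A ⊗[ℂ] A :=
  TensorProduct.homTensorHomMap (RingHom.id ℂ) A A A A ∘ₗ TensorProduct.map H.actL H.actL

@[simp] lemma actR₂_tmul (ω ρ : H.Dual) (x y : A) :
    H.actR₂ (ω ⊗ₜ ρ) (x ⊗ₜ y) = H.actR ω x ⊗ₜ H.actR ρ y := by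
  simp [actR₂]

@[simp] lemma actL₂_tmul (ω ρ : H.Dual) (x y : A) :
    H.actL₂ (ω ⊗ₜ ρ) (x ⊗ₜ y) = H.actL ω x ⊗ₜ H.actL ρ y := by
  simp [actL₂]

lemma pairing_mul (t s : H.Dual ⊗[ℂ] H.Dual) (z : A ⊗[ℂ] A) :
    H.pairing (t * s) z = H.pairing t (H.actR₂ s z) := by
  induction t with
  | zero => simp
  | add t u ht hu => simp only [add_mul, map_add, LinearMap.add_apply, ht, hu]
  | tmul a b =>
    induction s with
    | zero => simp
    | add t u ht hu => simp only [mul_add, map_add, LinearMap.add_apply, ht, hu]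
    | tmul c d =>
      induction z with
      | zero => simp
      | add t u ht hu => simp only [map_add, ht, hu]
      | tmul x y => simp [mul_apply]

lemma pairing_mul' (t s : H.Dual ⊗[ℂ] H.Dual) (z : A ⊗[ℂ] A) :
    H.pairing (t * s) z = H.pairing s (H.actL₂ t z) := by
  induction t with
  | zero => simp
  | add t u ht hu => simp only [add_mul, map_add, LinearMap.add_apply, ht, hu]
  | tmul a b =>
    induction s with
    | zero => simp
    | add t u ht hu => simp only [mul_add, map_add, LinearMap.add_apply, ht, hu]
    | tmul c d =>
      induction z with
      | zero => simp
      | add t u ht hu => simp only [map_add, ht, hu]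
      | tmul x y => simp [mul_apply']

lemma actR₂_mul (t s : H.Dual ⊗[ℂ] H.Dual) (z : A ⊗[ℂ] A) :
    H.actR₂ (t * s) z = H.actR₂ t (H.actR₂ s z) := by
  induction t with
  | zero => simp
  | add t u ht hu => simp only [add_mul, map_add, LinearMap.add_apply, ht, hu]
  | tmul a b =>
    induction s with
    | zero => simp
    | add t u ht hu => simp only [mul_add, map_add, LinearMap.add_apply, ht, hu]
    | tmul c d =>
      induction z with
      | zero => simp
      | add t u ht hu => simp only [map_add, ht, hu]
      | tmul x y => simp [actR_mul]

lemma actL₂_mul (t s : H.Dual ⊗[ℂ] H.Dual) (z : A ⊗[ℂ] A) :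
    H.actL₂ (t * s) z = H.actL₂ s (H.actL₂ t z) := by
  induction t with
  | zero => simp
  | add t u ht hu => simp only [add_mul, map_add, LinearMap.add_apply, ht, hu]
  | tmul a b =>
    induction s with
    | zero => simp
    | add t u ht hu => simp only [mul_add, map_add, LinearMap.add_apply, ht, hu]
    | tmul c d =>
      induction z with
      | zero => simp
      | add t u ht hu => simp only [map_add, ht, hu]
      | tmul x y => simp [actL_mul]

lemma act₂_comm (t s : H.Dual ⊗[ℂ] H.Dual) (z : A ⊗[ℂ] A) :
    H.actR₂ t (H.actL₂ s z) = H.actL₂ s (H.actR₂ t z) := by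
  induction t with
  | zero => simp
  | add t u ht hu => simp only [map_add, LinearMap.add_apply, ht, hu]
  | tmul a b =>
    induction s with
    | zero => simp
    | add t u ht hu => simp only [map_add, LinearMap.add_apply, ht, hu]
    | tmul c d =>
      induction z with
      | zero => simp
      | add t u ht hu => simp only [map_add, ht, hu]
      | tmul x y => simp [act_comm]

/-- The functional `x ⊗ y ↦ ω(xy)` on `A ⊗ A`. -/
noncomputable def mulDual : H.Dual →ₗ[ℂ] (A ⊗[ℂ] A →ₗ[ℂ] ℂ) :=
  (LinearMap.lcomp ℂ ℂ (LinearMap.mul' ℂ A)) ∘ₗ H.dualSpace.subtype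

@[simp] lemma mulDual_tmul (ω : H.Dual) (x y : A) : H.mulDual ω (x ⊗ₜ y) = ω.1 (x * y) := by
  simp [mulDual]

/-- A bilinear map into functionals on `A ⊗ A` with values in `Â ⊗ Â`, as a map to `Â ⊗ Â`. -/
noncomputable def lift {M N : Type*} [AddCommGroup M] [Module ℂ M] [AddCommGroup N] [Module ℂ N]
    (f : M →ₗ[ℂ] N →ₗ[ℂ] A ⊗[ℂ] A →ₗ[ℂ] ℂ) (hf : ∀ m n, ∃ t, H.pairing t = f m n) :
    M →ₗ[ℂ] N →ₗ[ℂ] H.Dual ⊗[ℂ] H.Dual :=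
  LinearMap.mk₂ ℂ (fun m n => (hf m n).choose)
    (fun m m' n => H.pairing_injective ((hf _ n).choose_spec.trans (by
      rw [map_add H.pairing, (hf m n).choose_spec, (hf m' n).choose_spec, map_add,
        LinearMap.add_apply])))
    (fun r m n => H.pairing_injective ((hf _ n).choose_spec.trans (by
      rw [map_smul H.pairing, (hf m n).choose_spec, map_smul, LinearMap.smul_apply])))
    (fun m n n' => H.pairing_injective ((hf m _).choose_spec.trans (by
      rw [map_add H.pairing, (hf m n).choose_spec, (hf m n').choose_spec, map_add])))
    (fun r m n => H.pairing_injective ((hf m _).choose_spec.trans (by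
      rw [map_smul H.pairing, (hf m n).choose_spec, map_smul])))

lemma pairing_lift {M N : Type*} [AddCommGroup M] [Module ℂ M] [AddCommGroup N] [Module ℂ N]
    (f : M →ₗ[ℂ] N →ₗ[ℂ] A ⊗[ℂ] A →ₗ[ℂ] ℂ) (hf : ∀ m n, ∃ t, H.pairing t = f m n) (m : M) (n : N) :
    H.pairing (H.lift f hf m n) = f m n := (hf m n).choose_spec

/-- `⟨Δ̂(ω)(1 ⊗ ρ), x ⊗ y⟩ = (ω ⊗ ρ)((x ⊗ 1)Δ(y)) = ω(x ((ι ⊗ ρ)Δ(y)))`. -/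
noncomputable def f₁ : H.Dual →ₗ[ℂ] H.Dual →ₗ[ℂ] A ⊗[ℂ] A →ₗ[ℂ] ℂ :=
  LinearMap.mk₂ ℂ (fun ω ρ => H.mulDual ω ∘ₗ TensorProduct.map LinearMap.id (H.actR ρ))
    (fun _ _ _ => by rw [map_add, LinearMap.add_comp])
    (fun _ _ _ => by rw [map_smul, LinearMap.smul_comp])
    (fun _ _ _ => by rw [map_add, TensorProduct.map_add_right, LinearMap.comp_add])
    (fun _ _ _ => by rw [map_smul, TensorProduct.map_smul_right, LinearMap.comp_smul])

/-- `⟨(ω ⊗ 1)Δ̂(ρ), x ⊗ y⟩ = (ω ⊗ ρ)(Δ(x)(1 ⊗ y)) = ρ(((ω ⊗ ι)Δ(x)) y)`. -/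
noncomputable def f₂ : H.Dual →ₗ[ℂ] H.Dual →ₗ[ℂ] A ⊗[ℂ] A →ₗ[ℂ] ℂ :=
  LinearMap.mk₂ ℂ (fun ω ρ => H.mulDual ρ ∘ₗ TensorProduct.map (H.actL ω) LinearMap.id)
    (fun _ _ _ => by rw [map_add, TensorProduct.map_add_left, LinearMap.comp_add])
    (fun _ _ _ => by rw [map_smul, TensorProduct.map_smul_left, LinearMap.comp_smul])
    (fun _ _ _ => by rw [map_add, LinearMap.add_comp])
    (fun _ _ _ => by rw [map_smul, LinearMap.smul_comp])

/-- `⟨Δ̂(ω)(ρ ⊗ 1), x ⊗ y⟩ = ω(((ι ⊗ ρ)Δ(x)) y)`. -/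
noncomputable def f₃ : H.Dual →ₗ[ℂ] H.Dual →ₗ[ℂ] A ⊗[ℂ] A →ₗ[ℂ] ℂ :=
  LinearMap.mk₂ ℂ (fun ω ρ => H.mulDual ω ∘ₗ TensorProduct.map (H.actR ρ) LinearMap.id)
    (fun _ _ _ => by rw [map_add, LinearMap.add_comp])
    (fun _ _ _ => by rw [map_smul, LinearMap.smul_comp])
    (fun _ _ _ => by rw [map_add, TensorProduct.map_add_left, LinearMap.comp_add])
    (fun _ _ _ => by rw [map_smul, TensorProduct.map_smul_left, LinearMap.comp_smul])

/-- `⟨(1 ⊗ ω)Δ̂(ρ), x ⊗ y⟩ = ρ(x ((ω ⊗ ι)Δ(y)))`. -/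
noncomputable def f₄ : H.Dual →ₗ[ℂ] H.Dual →ₗ[ℂ] A ⊗[ℂ] A →ₗ[ℂ] ℂ :=
  LinearMap.mk₂ ℂ (fun ω ρ => H.mulDual ρ ∘ₗ TensorProduct.map LinearMap.id (H.actL ω))
    (fun _ _ _ => by rw [map_add, TensorProduct.map_add_right, LinearMap.comp_add])
    (fun _ _ _ => by rw [map_smul, TensorProduct.map_smul_right, LinearMap.comp_smul])
    (fun _ _ _ => by rw [map_add, LinearMap.add_comp])
    (fun _ _ _ => by rw [map_smul, LinearMap.smul_comp])

@[simp] lemma f₁_apply (ω ρ : H.Dual) (x y : A) :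
    H.f₁ ω ρ (x ⊗ₜ y) = ω.1 (x * H.actR ρ y) := by simp [f₁]

@[simp] lemma f₂_apply (ω ρ : H.Dual) (x y : A) :
    H.f₂ ω ρ (x ⊗ₜ y) = ρ.1 (H.actL ω x * y) := by simp [f₂]

@[simp] lemma f₃_apply (ω ρ : H.Dual) (x y : A) :
    H.f₃ ω ρ (x ⊗ₜ y) = ω.1 (H.actR ρ x * y) := by simp [f₃]

@[simp] lemma f₄_apply (ω ρ : H.Dual) (x y : A) :
    H.f₄ ω ρ (x ⊗ₜ y) = ρ.1 (x * H.actL ω y) := by simp [f₄]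

lemma antipode_actR_fR (b y : A) :
    H.antipode (H.actR ⟨fR H.integral b, H.mem_fR b⟩ y) = H.rA (fL H.integral y) b := by
  rw [actR_eq, antipode_rA]

lemma antipode_actL_ψL (b y : A) :
    H.antipode (H.actL ⟨fL H.rightIntegral b, H.mem_ψL b⟩ y) = H.lA b (fR H.rightIntegral y) := by
  rw [actL_eq, antipode_rightIntegral]

lemma mem₁ (ω ρ : H.Dual) : ∃ t, H.pairing t = H.f₁ ω ρ := by
  obtain ⟨ω, hω⟩ := ω
  obtain ⟨ρ, hρ⟩ := ρ
  obtain ⟨a, rfl⟩ := id hω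
  obtain ⟨b, rfl⟩ := id hρ
  have key : ∀ t : A ⊗[ℂ] A, ∃ u, ∀ x y, H.pairing u (x ⊗ₜ y)
      = H.integral (H.antipode.symm (sliceR (fL H.integral y) t * H.antipode x)) := by
    intro t
    induction t with
    | zero => exact ⟨0, fun x y => by simp⟩
    | add t u ht hu =>
      obtain ⟨v, hv⟩ := ht
      obtain ⟨w, hw⟩ := hu
      exact ⟨v + w, fun x y => by simp [hv, hw, add_mul]⟩
    | tmul p q =>
      refine ⟨⟨_, H.mem_fR (H.antipode.symm p)⟩ ⊗ₜ ⟨_, H.mem_fR q⟩, fun x y => ?_⟩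
      simp [S_symm_mul, mul_comm, mul_smul_comm]
  obtain ⟨u, hu⟩ := key (H.T₂ (H.antipode a) b)
  refine ⟨u, TensorProduct.ext' fun x y => ?_⟩
  rw [hu, f₁_apply, ← H.mul_rA (fL_mem _ _), ← antipode_actR_fR]
  simp [S_symm_mul, mul_assoc]

lemma mem₂ (ω ρ : H.Dual) : ∃ t, H.pairing t = H.f₂ ω ρ := by
  obtain ⟨ω, hω⟩ := ω
  obtain ⟨ρ, hρ⟩ := ρ
  obtain ⟨b, rfl⟩ := H.ex_ψL hω
  obtain ⟨a, rfl⟩ := H.ex_ψL hρ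
  have key : ∀ t : A ⊗[ℂ] A, ∃ u, ∀ x y, H.pairing u (x ⊗ₜ y)
      = H.rightIntegral (H.antipode.symm (H.antipode y * sliceL (fR H.rightIntegral x) t)) := by
    intro t
    induction t with
    | zero => exact ⟨0, fun x y => by simp⟩
    | add t u ht hu =>
      obtain ⟨v, hv⟩ := ht
      obtain ⟨w, hw⟩ := hu
      exact ⟨v + w, fun x y => by simp [hv, hw, mul_add]⟩
    | tmul p q =>
      refine ⟨⟨_, H.mem_ψL p⟩ ⊗ₜ ⟨_, H.mem_ψL (H.antipode.symm q)⟩, fun x y => ?_⟩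
      simp [S_symm_mul, smul_mul_assoc]
  obtain ⟨u, hu⟩ := key (H.T₁ b (H.antipode a))
  refine ⟨u, TensorProduct.ext' fun x y => ?_⟩
  rw [hu, f₂_apply, ← H.lA_mul (fR_mem _ _), ← antipode_actL_ψL]
  simp [S_symm_mul, mul_assoc]

lemma mem₃ (ω ρ : H.Dual) : ∃ t, H.pairing t = H.f₃ ω ρ := by
  obtain ⟨ω, hω⟩ := ω
  obtain ⟨ρ, hρ⟩ := ρ
  obtain ⟨a, rfl⟩ := H.ex_φL hω
  obtain ⟨b, rfl⟩ := id hρ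
  have key : ∀ t : A ⊗[ℂ] A, ∃ u, ∀ x y, H.pairing u (x ⊗ₜ y)
      = H.integral (H.antipode.symm (H.antipode y * sliceR (fL H.integral x) t)) := by
    intro t
    induction t with
    | zero => exact ⟨0, fun x y => by simp⟩
    | add t u ht hu =>
      obtain ⟨v, hv⟩ := ht
      obtain ⟨w, hw⟩ := hu
      exact ⟨v + w, fun x y => by simp [hv, hw, mul_add]⟩
    | tmul p q =>
      refine ⟨⟨_, H.mem_fR q⟩ ⊗ₜ ⟨_, H.mem_φL (H.antipode.symm p)⟩, fun x y => ?_⟩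
      simp [S_symm_mul, smul_mul_assoc]
  obtain ⟨u, hu⟩ := key (H.T₃ b (H.antipode a))
  refine ⟨u, TensorProduct.ext' fun x y => ?_⟩
  rw [hu, f₃_apply, ← H.rA_mul (fL_mem _ _), ← antipode_actR_fR]
  simp [S_symm_mul, mul_assoc]

lemma mem₄ (ω ρ : H.Dual) : ∃ t, H.pairing t = H.f₄ ω ρ := by
  obtain ⟨ω, hω⟩ := ω
  obtain ⟨ρ, hρ⟩ := ρ
  obtain ⟨a, rfl⟩ := H.ex_ψL hω
  obtain ⟨b, rfl⟩ := H.ex_ψR hρ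
  have key : ∀ t : A ⊗[ℂ] A, ∃ u, ∀ x y, H.pairing u (x ⊗ₜ y)
      = H.rightIntegral (H.antipode.symm (sliceL (fR H.rightIntegral y) t * H.antipode x)) := by
    intro t
    induction t with
    | zero => exact ⟨0, fun x y => by simp⟩
    | add t u ht hu =>
      obtain ⟨v, hv⟩ := ht
      obtain ⟨w, hw⟩ := hu
      exact ⟨v + w, fun x y => by simp [hv, hw, add_mul]⟩
    | tmul p q =>
      refine ⟨⟨_, H.mem_ψR (H.antipode.symm q)⟩ ⊗ₜ ⟨_, H.mem_ψL p⟩, fun x y => ?_⟩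
      simp [S_symm_mul, mul_comm, mul_smul_comm]
  obtain ⟨u, hu⟩ := key (H.T₄ (H.antipode b) a)
  refine ⟨u, TensorProduct.ext' fun x y => ?_⟩
  rw [hu, f₄_apply, ← H.mul_lA (fR_mem _ _), ← antipode_actL_ψL]
  simp [S_symm_mul, mul_assoc]

/-- `t ↦ ⟨Δ̂(ω) t, ·⟩`. -/
noncomputable def fLeft : H.Dual →ₗ[ℂ] H.Dual ⊗[ℂ] H.Dual →ₗ[ℂ] A ⊗[ℂ] A →ₗ[ℂ] ℂ :=
  LinearMap.mk₂ ℂ (fun ω t => H.mulDual ω ∘ₗ H.actR₂ t)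
    (fun _ _ _ => by rw [map_add, LinearMap.add_comp])
    (fun _ _ _ => by rw [map_smul, LinearMap.smul_comp])
    (fun _ _ _ => by rw [map_add, LinearMap.comp_add])
    (fun _ _ _ => by rw [map_smul, LinearMap.comp_smul])

/-- `t ↦ ⟨t Δ̂(ω), ·⟩`. -/
noncomputable def fRight : H.Dual →ₗ[ℂ] H.Dual ⊗[ℂ] H.Dual →ₗ[ℂ] A ⊗[ℂ] A →ₗ[ℂ] ℂ :=
  LinearMap.mk₂ ℂ (fun ω t => H.mulDual ω ∘ₗ H.actL₂ t)
    (fun _ _ _ => by rw [map_add, LinearMap.add_comp])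
    (fun _ _ _ => by rw [map_smul, LinearMap.smul_comp])
    (fun _ _ _ => by rw [map_add, LinearMap.comp_add])
    (fun _ _ _ => by rw [map_smul, LinearMap.comp_smul])

lemma fLeft_apply (ω : H.Dual) (t : H.Dual ⊗[ℂ] H.Dual) (z : A ⊗[ℂ] A) :
    H.fLeft ω t z = H.mulDual ω (H.actR₂ t z) := rfl

lemma fRight_apply (ω : H.Dual) (t : H.Dual ⊗[ℂ] H.Dual) (z : A ⊗[ℂ] A) :
    H.fRight ω t z = H.mulDual ω (H.actL₂ t z) := rfl

lemma pairing_map_mulRight (ω : H.Dual) (u : H.Dual ⊗[ℂ] H.Dual) (x y : A) :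
    H.pairing (TensorProduct.map (LinearMap.mulRight ℂ ω) LinearMap.id u) (x ⊗ₜ y)
      = H.pairing u (H.actR ω x ⊗ₜ y) := by
  induction u with
  | zero => simp
  | add t u ht hu => simp only [map_add, LinearMap.add_apply, ht, hu]
  | tmul a b => simp [mul_apply]

lemma pairing_map_mulLeft (ω : H.Dual) (u : H.Dual ⊗[ℂ] H.Dual) (x y : A) :
    H.pairing (TensorProduct.map LinearMap.id (LinearMap.mulLeft ℂ ω) u) (x ⊗ₜ y)
      = H.pairing u (x ⊗ₜ H.actL ω y) := by
  induction u with
  | zero => simp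
  | add t u ht hu => simp only [map_add, LinearMap.add_apply, ht, hu]
  | tmul a b => simp [mul_apply']

lemma memLeft (ω : H.Dual) (t : H.Dual ⊗[ℂ] H.Dual) : ∃ u, H.pairing u = H.fLeft ω t := by
  induction t with
  | zero => exact ⟨0, by simp⟩
  | add t u ht hu =>
    obtain ⟨v, hv⟩ := ht
    obtain ⟨w, hw⟩ := hu
    exact ⟨v + w, by rw [map_add, map_add, hv, hw]⟩
  | tmul a b =>
    obtain ⟨u, hu⟩ := H.mem₁ ω b
    refine ⟨_, TensorProduct.ext' fun x y => (H.pairing_map_mulRight a u x y).trans ?_⟩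
    rw [hu, fLeft_apply]
    simp

lemma memRight (ω : H.Dual) (t : H.Dual ⊗[ℂ] H.Dual) : ∃ u, H.pairing u = H.fRight ω t := by
  induction t with
  | zero => exact ⟨0, by simp⟩
  | add t u ht hu =>
    obtain ⟨v, hv⟩ := ht
    obtain ⟨w, hw⟩ := hu
    exact ⟨v + w, by rw [map_add, map_add, hv, hw]⟩
  | tmul a b =>
    obtain ⟨u, hu⟩ := H.mem₂ a ω
    refine ⟨_, TensorProduct.ext' fun x y => (H.pairing_map_mulLeft b u x y).trans ?_⟩
    rw [hu, fRight_apply]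
    simp

/-- The comultiplication of the dual, dual to the product of `A`: the multiplier `Δ̂(ω)` of
`Â ⊗ Â` is given by `⟨Δ̂(ω) t, z⟩ = ⟨ω, m(t ▸ z)⟩` and `⟨t Δ̂(ω), z⟩ = ⟨ω, m(z ◂ t)⟩`
where `m` is the product of `A` and `▸`, `◂` are the actions of `Â ⊗ Â` on `A ⊗ A`. -/
noncomputable def dualComul : H.Dual →ₗ[ℂ] Multiplier (H.Dual ⊗[ℂ] H.Dual) where
  toFun ω := Multiplier.mk (H.lift H.fLeft H.memLeft ω) (H.lift H.fRight H.memRight ω)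
    (fun t s => H.pairing_injective (LinearMap.ext fun z => by
      rw [pairing_lift, pairing_mul, pairing_lift, fLeft_apply, fLeft_apply, actR₂_mul]))
    (fun t s => H.pairing_injective (LinearMap.ext fun z => by
      rw [pairing_lift, pairing_mul', pairing_lift, fRight_apply, fRight_apply, actL₂_mul]))
    (fun t s => H.pairing_injective (LinearMap.ext fun z => by
      rw [pairing_mul', pairing_lift, pairing_mul, pairing_lift, fLeft_apply, fRight_apply,
        act₂_comm]))
  map_add' ω ρ := Multiplier.ext'
    (fun t => LinearMap.congr_fun ((H.lift H.fLeft H.memLeft).map_add ω ρ) t)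
    (fun t => LinearMap.congr_fun ((H.lift H.fRight H.memRight).map_add ω ρ) t)
  map_smul' r ω := Multiplier.ext'
    (fun t => LinearMap.congr_fun ((H.lift H.fLeft H.memLeft).map_smul r ω) t)
    (fun t => LinearMap.congr_fun ((H.lift H.fRight H.memRight).map_smul r ω) t)

lemma pairing_dualComul_left (ω : H.Dual) (t : H.Dual ⊗[ℂ] H.Dual) (z : A ⊗[ℂ] A) :
    H.pairing (Multiplier.left (H.dualComul ω) t) z = H.mulDual ω (H.actR₂ t z) :=
  LinearMap.congr_fun (H.pairing_lift H.fLeft H.memLeft ω t) z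

lemma pairing_dualComul_right (ω : H.Dual) (t : H.Dual ⊗[ℂ] H.Dual) (z : A ⊗[ℂ] A) :
    H.pairing (Multiplier.right (H.dualComul ω) t) z = H.mulDual ω (H.actL₂ t z) :=
  LinearMap.congr_fun (H.pairing_lift H.fRight H.memRight ω t) z

lemma actR₂_id (ρ : H.Dual) (t : H.Dual ⊗[ℂ] H.Dual) (z : A ⊗[ℂ] A) :
    H.actR₂ (TensorProduct.map LinearMap.id (LinearMap.mulLeft ℂ ρ) t) z
      = TensorProduct.map LinearMap.id (H.actR ρ) (H.actR₂ t z) := by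
  induction t with
  | zero => simp
  | add t u ht hu => simp only [map_add, LinearMap.add_apply, ht, hu]
  | tmul a b =>
    induction z with
    | zero => simp
    | add t u ht hu => simp only [map_add, ht, hu]
    | tmul x y => simp [actR_mul]

lemma actR₂_id' (ρ : H.Dual) (t : H.Dual ⊗[ℂ] H.Dual) (z : A ⊗[ℂ] A) :
    H.actR₂ (TensorProduct.map (LinearMap.mulLeft ℂ ρ) LinearMap.id t) z
      = TensorProduct.map (H.actR ρ) LinearMap.id (H.actR₂ t z) := by
  induction t with
  | zero => simp
  | add t u ht hu => simp only [map_add, LinearMap.add_apply, ht, hu]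
  | tmul a b =>
    induction z with
    | zero => simp
    | add t u ht hu => simp only [map_add, ht, hu]
    | tmul x y => simp [actR_mul]

lemma actL₂_id (ρ : H.Dual) (t : H.Dual ⊗[ℂ] H.Dual) (z : A ⊗[ℂ] A) :
    H.actL₂ (TensorProduct.map LinearMap.id (LinearMap.mulRight ℂ ρ) t) z
      = TensorProduct.map LinearMap.id (H.actL ρ) (H.actL₂ t z) := by
  induction t with
  | zero => simp
  | add t u ht hu => simp only [map_add, LinearMap.add_apply, ht, hu]
  | tmul a b =>
    induction z with
    | zero => simp
    | add t u ht hu => simp only [map_add, ht, hu]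
    | tmul x y => simp [actL_mul]

lemma actL₂_id' (ρ : H.Dual) (t : H.Dual ⊗[ℂ] H.Dual) (z : A ⊗[ℂ] A) :
    H.actL₂ (TensorProduct.map (LinearMap.mulRight ℂ ρ) LinearMap.id t) z
      = TensorProduct.map (H.actL ρ) LinearMap.id (H.actL₂ t z) := by
  induction t with
  | zero => simp
  | add t u ht hu => simp only [map_add, LinearMap.add_apply, ht, hu]
  | tmul a b =>
    induction z with
    | zero => simp
    | add t u ht hu => simp only [map_add, ht, hu]
    | tmul x y => simp [actL_mul]

lemma dual₂_nondegenerate : NondegenerateMul (H.Dual ⊗[ℂ] H.Dual) :=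
  nondegenerateMul_tensor H.dual_nondegenerate

/-- The dual algebra with its comultiplication. -/
noncomputable def dualComultiplication : RegularComultiplication H.Dual where
  nondegenerate := H.dual_nondegenerate
  comul := H.dualComul
  T₁ := H.lift H.f₁ H.mem₁
  T₂ := H.lift H.f₂ H.mem₂
  T₃ := H.lift H.f₃ H.mem₃
  T₄ := H.lift H.f₄ H.mem₄
  of_T₁ ω ρ := Multiplier.ext_left H.dual₂_nondegenerate fun t =>
    H.pairing_injective (LinearMap.ext fun z => by
      rw [Multiplier.left_of, pairing_mul, pairing_lift, Multiplier.left_mul_apply,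
        pairing_dualComul_left]
      exact congrArg (H.mulDual ω) (H.actR₂_id ρ t z).symm)
  of_T₂ ω ρ := Multiplier.ext_right H.dual₂_nondegenerate fun t =>
    H.pairing_injective (LinearMap.ext fun z => by
      rw [Multiplier.right_of, pairing_mul', pairing_lift, Multiplier.right_mul_apply,
        pairing_dualComul_right]
      exact congrArg (H.mulDual ρ) (H.actL₂_id' ω t z).symm)
  of_T₃ ω ρ := Multiplier.ext_left H.dual₂_nondegenerate fun t =>
    H.pairing_injective (LinearMap.ext fun z => by
      rw [Multiplier.left_of, pairing_mul, pairing_lift, Multiplier.left_mul_apply,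
        pairing_dualComul_left]
      exact congrArg (H.mulDual ω) (H.actR₂_id' ρ t z).symm)
  of_T₄ ω ρ := Multiplier.ext_right H.dual₂_nondegenerate fun t =>
    H.pairing_injective (LinearMap.ext fun z => by
      rw [Multiplier.right_of, pairing_mul', pairing_lift, Multiplier.right_mul_apply,
        pairing_dualComul_right]
      exact congrArg (H.mulDual ρ) (H.actL₂_id ω t z).symm)
  coassoc a b c := by
    refine H.tensor_ext_ev fun x => H.pairing_ext fun y z => ?_
    have h1 : ∀ t : H.Dual ⊗[ℂ] H.Dual,
        H.pairing (sliceL (H.ev x) (TensorProduct.assoc ℂ H.Dual H.Dual H.Dual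
          (TensorProduct.map (H.lift H.f₂ H.mem₂ a) LinearMap.id t))) (y ⊗ₜ z)
        = H.pairing t ((H.actL a x * y) ⊗ₜ z) := by
      intro t
      have h2 : ∀ (s : H.Dual ⊗[ℂ] H.Dual) (ρ : H.Dual),
          H.pairing (sliceL (H.ev x) (TensorProduct.assoc ℂ H.Dual H.Dual H.Dual (s ⊗ₜ ρ))) (y ⊗ₜ z)
          = H.pairing s (x ⊗ₜ y) * ρ.1 z := by
        intro s ρ
        induction s with
        | zero => simp
        | add s u hs hu =>
          simp only [TensorProduct.add_tmul, map_add, LinearMap.add_apply, hs, hu, add_mul]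
        | tmul p q => simp [ev_apply, mul_assoc]
      induction t with
      | zero => simp
      | add t u ht hu => simp only [map_add, LinearMap.add_apply, ht, hu]
      | tmul p q => rw [TensorProduct.map_tmul, h2, pairing_lift]; simp
    rw [h1, pairing_lift, sliceL_map, LinearMap.flip_apply, pairing_lift, f₁_apply, f₁_apply,
      LinearMap.comp_id, sliceL_ev, pairing_lift, f₂_apply, mul_assoc]

/-- The counit of the dual: `ε̂(φ(· a)) = φ(a)`. -/
noncomputable def dualCounit : H.Dual →ₗ[ℂ] ℂ := H.integral ∘ₗ H.hat.symm.toLinearMap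

lemma dualCounit_fR (ω : H.Dual) (a : A) (h : ω.1 = fR H.integral a) :
    H.dualCounit ω = H.integral a := by
  have : ω = H.hat a := Subtype.ext h
  rw [this]
  simp [dualCounit]

lemma dualCounit_fL (ω : H.Dual) (a : A) (h : ω.1 = fL H.integral a) :
    H.dualCounit ω = H.integral a := by
  obtain ⟨b, hb⟩ := ω.2
  rw [H.dualCounit_fR ω b hb]
  obtain ⟨x, hx⟩ := H.exists_integral_ne
  refine mul_right_cancel₀ hx ?_
  rw [← integral_lA_fR, ← integral_lA_fL, ← h, hb]

lemma dualCounit_mul (ω ρ : H.Dual) :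
    H.dualCounit (ω * ρ) = H.dualCounit ω * H.dualCounit ρ := by
  obtain ⟨a, ha⟩ := ω.2
  obtain ⟨b, hb⟩ := ρ.2
  rw [H.dualCounit_fR ω a ha, H.dualCounit_fR ρ b hb,
    H.dualCounit_fR (ω * ρ) (H.lA b (ω.1 ∘ₗ H.antipode.symm.toLinearMap))]
  · have : ω.1 ∘ₗ H.antipode.symm.toLinearMap
        = fL (H.integral ∘ₗ H.antipode.symm.toLinearMap) (H.antipode a) :=
      LinearMap.ext fun x => by simp [ha, S_symm_mul]
    rw [this, integral_lA_fL]
    simp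
  · refine LinearMap.ext fun x => ?_
    rw [mul_apply, actR_eq, hb, H.apply_rA_fR (H.cov ω)]
    rfl

/-- The left integral of the dual: `φ̂(ψ(a ·)) = ε(a)`. -/
noncomputable def dualIntegral : H.Dual →ₗ[ℂ] ℂ := H.counit ∘ₗ H.hatψ.symm.toLinearMap

lemma dualIntegral_ψL (ω : H.Dual) (a : A) (h : ω.1 = fL H.rightIntegral a) :
    H.dualIntegral ω = H.counit a := by
  have : ω = H.hatψ a := Subtype.ext h
  rw [this]
  simp [dualIntegral]

lemma dualIntegral_mul (ω ρ : H.Dual) (a : A) (h : ω.1 = fL H.rightIntegral a) :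
    H.dualIntegral (ω * ρ) = ρ.1 (H.antipode.symm a) := by
  rw [H.dualIntegral_ψL (ω * ρ) (H.rA (ρ.1 ∘ₗ H.antipode.symm.toLinearMap) a),
    H.counit_rA (H.cov_S_symm (H.cov ρ))]
  · rfl
  · refine LinearMap.ext fun x => ?_
    rw [mul_apply', actL_eq, h, H.apply_lA_fL (H.cov ρ)]
    rfl

/-- The antipode of the dual: `Ŝ(ω) = ω ∘ S`. -/
noncomputable def dualAntipode : H.Dual ≃ₗ[ℂ] H.Dual where
  toFun ω := ⟨ω.1 ∘ₗ H.antipode.toLinearMap, H.mem_S ω.2⟩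
  map_add' _ _ := rfl
  map_smul' _ _ := rfl
  invFun ω := ⟨ω.1 ∘ₗ H.antipode.symm.toLinearMap, H.mem_S_symm ω.2⟩
  left_inv ω := H.dual_ext fun x => by simp
  right_inv ω := H.dual_ext fun x => by simp

lemma dualAntipode_apply (ω : H.Dual) (x : A) :
    (H.dualAntipode ω).1 x = ω.1 (H.antipode x) := rfl

lemma dual_isCounit : H.dualComultiplication.IsCounit H.dualCounit := by
  refine ⟨H.dualCounit_mul, fun ω => ?_, fun ω => ?_⟩
  · refine Multiplier.ext_left H.dual_nondegenerate fun ρ => H.dual_ext fun y => ?_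
    change H.ev y (sliceL H.dualCounit (H.lift H.f₁ H.mem₁ ω ρ)) = (ω * ρ).1 y
    rw [← sliceR_sliceL]
    obtain ⟨a, ha⟩ := ω.2
    rw [H.dualCounit_fR _ (H.actR ρ y * a)]
    · rw [mul_apply, ha, fR_apply]
    · refine LinearMap.ext fun x => ?_
      rw [sliceR_ev, pairing_lift, f₁_apply, ha, fR_apply, fR_apply, mul_assoc]
  · refine Multiplier.ext_left H.dual_nondegenerate fun ρ => H.dual_ext fun x => ?_
    change H.ev x (sliceR H.dualCounit (H.lift H.f₃ H.mem₃ ω ρ)) = (ω * ρ).1 x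
    rw [sliceR_sliceL]
    obtain ⟨a, ha⟩ := H.ex_φL ω.2
    rw [H.dualCounit_fL _ (a * H.actR ρ x)]
    · rw [mul_apply, ha, fL_apply]
    · refine LinearMap.ext fun y => ?_
      rw [sliceL_ev, pairing_lift, f₃_apply, ha, fL_apply, fL_apply, mul_assoc]

lemma dual_isLeftIntegral : H.dualComultiplication.IsLeftIntegral H.dualIntegral := by
  refine ⟨fun h => ?_, fun ω => ?_⟩
  · obtain ⟨a, ha⟩ := H.exists_counit_ne
    refine ha ?_
    rw [← H.dualIntegral_ψL ⟨_, H.mem_ψL a⟩ a rfl, h, LinearMap.zero_apply]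
  · refine Multiplier.ext_right H.dual_nondegenerate fun ρ => H.dual_ext fun x => ?_
    change H.ev x (sliceR H.dualIntegral (H.lift H.f₂ H.mem₂ ρ ω)) = H.dualIntegral ω * ρ.1 x
    rw [sliceR_sliceL]
    obtain ⟨a, ha⟩ := H.ex_ψL ω.2
    rw [H.dualIntegral_ψL _ (a * H.actL ρ x), H.dualIntegral_ψL _ a ha, H.isCounit.1]
    · congr 1
      rw [actL_eq, H.counit_lA (H.cov ρ)]
    · refine LinearMap.ext fun y => ?_
      rw [sliceL_ev, pairing_lift, f₂_apply, ha, fL_apply, fL_apply, mul_assoc]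

lemma dual_isFaithful : IsFaithful H.dualIntegral := by
  constructor
  · intro ω h
    obtain ⟨a, ha⟩ := H.ex_ψL ω.2
    have : H.antipode.symm a = 0 := H.eq_of_dual' fun ρ => by
      rw [← H.dualIntegral_mul ω ρ a ha, h, map_zero]
    have h0 : a = 0 := by simpa using this
    refine H.dual_ext fun x => ?_
    rw [ha, h0]
    simp
  · intro ρ h
    refine H.dual_ext fun x => ?_
    have := h ⟨_, H.mem_ψL (H.antipode x)⟩
    rw [H.dualIntegral_mul _ ρ _ rfl] at this
    simpa using this

lemma dual_isAntipode :
    H.dualComultiplication.IsAntipode H.dualIntegral H.dualAntipode := by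
  constructor
  · intro ω ρ
    refine H.dual_ext fun x => ?_
    rw [dualAntipode_apply, mul_apply, mul_apply', dualAntipode_apply, actR_eq, actL_eq,
      ← H.antipode_lA (H.cov ρ)]
    rfl
  · intro ω ρ
    refine H.dual_ext fun x => ?_
    rw [dualAntipode_apply]
    change H.ev _ (sliceR H.dualIntegral (H.lift H.f₁ H.mem₁ ω ρ))
      = H.ev x (sliceR H.dualIntegral (H.lift H.f₄ H.mem₄ ω ρ))
    rw [sliceR_sliceL, sliceR_sliceL]
    obtain ⟨a, ha⟩ := H.ex_ψL ω.2
    have h1 : sliceL (H.ev (H.antipode x)) (H.lift H.f₁ H.mem₁ ω ρ)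
        = ⟨_, H.mem_ψL (a * H.antipode x)⟩ * ρ := by
      refine H.dual_ext fun y => ?_
      rw [sliceL_ev, pairing_lift, f₁_apply, mul_apply, ha, fL_apply, fL_apply, mul_assoc]
    have h2 : sliceL (H.ev x) (H.lift H.f₄ H.mem₄ ω ρ)
        = ω * ⟨_, H.mem_fL_dual ρ.2 x⟩ := by
      refine H.dual_ext fun y => ?_
      rw [sliceL_ev, pairing_lift, f₄_apply, mul_apply', fL_apply]
    rw [h1, h2, H.dualIntegral_mul _ _ _ rfl, H.dualIntegral_mul _ _ _ ha, S_symm_mul]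
    simp

/-- The dual algebraic quantum hypergroup. -/
noncomputable def dual : AlgebraicQuantumHypergroup H.Dual where
  toRegularComultiplication := H.dualComultiplication
  counit := H.dualCounit
  isCounit := H.dual_isCounit
  integral := H.dualIntegral
  isLeftIntegral := H.dual_isLeftIntegral
  isFaithful := H.dual_isFaithful
  antipode := H.dualAntipode
  isAntipode := H.dual_isAntipode

end AlgebraicQuantumHypergroup

end QuantumHypergroup

/-! Both conditions are equivalent to a third one: the counit `ε̂` of the dual is evaluation at some
element `e` of `A`, that is, `ω(e) = ε̂(ω)` for all `ω` in `Â`. Such an `e` is then the identity of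
`A`. The link with co-integrals is the product of `Â` in the form `(ωρ)(x) = ω((ι ⊗ ρ)Δ(x))`. In
this form, left multiplication by `ω` in the dual is evaluation of `ω` on slices of `Δ(x)`, and
these slices lie in `A` because `ρ` is in `Â`.

Suppose that `A` has an identity `e`. Then `φ = φ(· e)` belongs to `Â`, and left invariance `(ι ⊗
φ)Δ(x) = φ(x)1` turns into `ωφ = ω(e)φ`. On the other hand, if `ω = φ(· a)` then `ε̂(ω) = φ(a) =
φ(ea) = ω(e)`. So `φ` is a left co-integral of the dual (`isLeftCointegral_dual_hat_one`).

Conversely, let `h` be a left co-integral of the dual. Evaluating `ωh = ε̂(ω)h` at `x` gives `ω((ι ⊗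
h)Δ(x)) = ε̂(ω)h(x)`. If `h(x) ≠ 0`, division by `h(x)` gives an element `e` of `A` at which every
`ω` takes the value `ε̂(ω)` (`exists_ev_eq_dualCounit`). With `ω = φ(· a)` this says `φ(ea) = φ(a)`
for all `a`. Faithfulness of `φ` upgrades this to `ea = a`, and non-degeneracy of the product then
yields `ae = a` (`isIdentity_of_ev_eq_dualCounit`). -/

namespace QuantumHypergroup.AlgebraicQuantumHypergroup

open RegularComultiplication

variable {A : Type*} [NonUnitalRing A] [Module ℂ A] [IsScalarTower ℂ A A] [SMulCommClass ℂ A A]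
variable (H : AlgebraicQuantumHypergroup A)

/-! ### From an identity of the algebra to a co-integral of the dual -/

/-- If `A` has an identity then the left integral `φ` belongs to `Â` and is a left co-integral. -/
lemma isLeftCointegral_dual_hat_one {e : A} (he : ∀ a, e * a = a ∧ a * e = a) :
    H.dual.IsLeftCointegral ⟨fR H.integral e, H.mem_fR e⟩ := by
  -- This is what the identity provides on the dual side: elements of `Â` have the form `φ(· a)`,
  -- and `a = e` recovers `φ` itself.
  have hφ : fR H.integral e = H.integral := LinearMap.ext fun x => by rw [fR_apply, (he x).2]
  -- Left invariance of `φ` is an equation in `M(A)`, whose right-hand side is a multiple of the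
  -- unit multiplier. To read it inside `A`, that unit has to be recognised as the image of `e`. By
  -- non-degeneracy it is enough to compare left multiplications.
  have hone : Multiplier.of e = (1 : Multiplier A) :=
    Multiplier.ext_left H.nondegenerate fun x => by simp [(he x).1]
  -- The co-integral is non-zero because it is the functional `φ`, and a left integral is non-zero
  -- by definition.
  refine ⟨fun h => H.isLeftIntegral.1 (hφ ▸ congrArg Subtype.val h), fun ω => ?_⟩
  refine H.dual_ext fun x => ?_
  -- Left invariance inside `A`: the slice `(ι ⊗ φ)Δ(x)` is the element `φ(x)e`. The element `rA` is
  -- characterised by its image in `M(A)`, so it suffices that `φ(x)e` has the image `φ(x)1` there.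
  have hact : H.actR ⟨fR H.integral e, H.mem_fR e⟩ x = H.integral x • e := by
    rw [actR_eq]
    change H.rA (fR H.integral e) x = _
    exact H.rA_eq (by rw [hφ, H.isLeftIntegral.2 x, map_smul, hone])
  obtain ⟨a, ha⟩ := ω.2
  -- The counit of the dual is evaluation at the identity: with `ω = φ(· a)`, both sides are `φ(a) =
  -- φ(ea)`.
  have hcounit : H.dualCounit ω = ω.1 e := by
    rw [H.dualCounit_fR ω a ha, ha, fR_apply, (he a).1]
  -- The scalar multiple `ε̂(ω)φ` is evaluated pointwise at `x`, and the counit carried by `H.dual`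
  -- unfolds to `dualCounit`. What remains is `ω(φ(x)e) = ω(e)φ(x)`, which is linearity of `ω`.
  change _ = H.dualCounit ω * fR H.integral e x
  rw [mul_apply, hact, hcounit, hφ, map_smul, smul_eq_mul, mul_comm]

/-! ### From a co-integral of the dual to an identity of the algebra -/

/-- An element representing the counit of the dual by evaluation is an identity of `A`. -/
lemma isIdentity_of_ev_eq_dualCounit {e : A} (he : ∀ ω : H.Dual, ω.1 e = H.dualCounit ω) (a : A) :
    e * a = a ∧ a * e = a := by
  -- The hypothesis is tested on `ω = φ(· a)`, for which `ω(e) = φ(ea)` and `ε̂(ω) = φ(a)`.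
  have hφ (a : A) : H.integral (e * a) = H.integral a :=
    (he ⟨_, H.mem_fR a⟩).trans (H.dualCounit_fR _ a rfl)
  -- A scalar identity becomes one in `A` by using `ab` in place of `a`: `φ((ea)b) = φ(e(ab)) =
  -- φ(ab)`, so `φ((ea - a)b) = 0` for every `b`, and `φ` is faithful.
  have hl (a : A) : e * a = a := sub_eq_zero.1 (H.isFaithful.1 _ fun b => by
    rw [sub_mul, map_sub, mul_assoc, hφ, sub_self])
  -- In a non-degenerate algebra a left identity is also a right identity: `(ae)b = a(eb) = ab` for
  -- all `b`, so `ae - a` annihilates every `b` from the left. The functional `φ` plays no further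
  -- role.
  exact ⟨hl a, sub_eq_zero.1 (H.nondegenerate.1 _ fun b => by
    rw [sub_mul, mul_assoc, hl, sub_self])⟩

/-- A left co-integral of the dual yields an element representing the counit of the dual. -/
lemma exists_ev_eq_dualCounit {h : H.Dual} (hh : H.dual.IsLeftCointegral h) :
    ∃ e : A, ∀ ω : H.Dual, ω.1 e = H.dualCounit ω := by
  obtain ⟨hne, hmul⟩ := hh
  -- A co-integral is non-zero as an element of `Â`, hence as a functional on `A`. A point where it
  -- does not vanish serves to normalise the slice below.
  obtain ⟨x, hx⟩ : ∃ x, h.1 x ≠ 0 := by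
    by_contra! h0
    exact hne (H.dual_ext h0)
  -- The witness is the normalised slice `(ι ⊗ h)Δ(x)`, an element of `A` because `h` is in `Â`. The
  -- choice is suggested by the other direction, where the co-integral is the left integral `φ` and
  -- the slice `(ι ⊗ φ)Δ(x)` equals `φ(x)e`; dividing by the value at `x` recovers `e`.
  refine ⟨(h.1 x)⁻¹ • H.actR h x, fun ω => ?_⟩
  -- This is the co-integral equation `ωh = ε̂(ω)h` evaluated at `x`. Its left-hand side is `ω` on
  -- the slice by the very definition of the product of `Â`, so no rewriting is needed.
  have key : ω.1 (H.actR h x) = H.dualCounit ω * h.1 x :=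
    congrArg (fun η : H.Dual => η.1 x) (hmul ω)
  rw [map_smul, key, smul_eq_mul]
  -- Here `h(x)⁻¹` cancels against `h(x)`, by the choice of `x` in `hx`.
  field_simp

end QuantumHypergroup.AlgebraicQuantumHypergroup

theorem proposition3p15 {A : Type*} [NonUnitalRing A] [Module ℂ A] [IsScalarTower ℂ A A]
    [SMulCommClass ℂ A A] (H : QuantumHypergroup.AlgebraicQuantumHypergroup A) :
    H.IsCompactType ↔ H.dual.IsDiscreteType := by
  constructor
  · rintro ⟨e, he⟩
    -- The co-integral left to unification is `φ(· e)`, which is the left integral `φ` seen as an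
    -- element of `Â`.
    exact ⟨_, H.isLeftCointegral_dual_hat_one he⟩
  · rintro ⟨h, hh⟩
    -- The co-integral is used only through the element of `A` that represents `ε̂`; that this
    -- element is a two-sided identity is a property of `A` and `φ` alone.
    obtain ⟨e, he⟩ := H.exists_ev_eq_dualCounit hh
    exact ⟨e, H.isIdentity_of_ev_eq_dualCounit he⟩
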